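/- **Problem.** $n$ agents communicate over a connected undirected graph with a weight matrix $\mathbf W\in\mathbb R^{n\times n}$ supported on the edges and the diagonal, symmetric and doubly stochastic, with $\operatorname{null}(\mathbf I-\mathbf W)=\operatorname{span}\{\mathbf 1\}$ and $\mathbf I+\mathbf W\succ0$. Let $\mathbf H=\frac1n\mathbf 1\mathbf 1^{\mathsf T}$, $\delta=1-\|\mathbf W-\mathbf H\|_2$ and $\beta=\|\mathbf I-\mathbf W\|_2$. Let $d\ge1$, let $\Omega\subseteq\mathbb R^d$ be closed and convex, and let $\underline R,\bar R>0$ be such that $\Omega$ contains the centred closed ball of radius $\underline R$ and lies in the centred closed ball of radius $\bar R$. Let $f_i(x)=\mathbb E_{\xi_i\sim\mathcal P_i}[F_i(x,\xi_i)]$ $(x\in\Omega)$, where $F_i(\cdot,\xi_i)$ is convex and $L_f$-Lipschitz on $\Omega$ for almost every $\xi_i$ (no smoothness is assumed), let $f=\frac1n\sum_{i=1}^n f_i$, and let $x^*\in\Omega$ be any minimizer of $f$ over $\Omega$. Let $\mathcal C$ be a (possibly randomized) compressor with $\mathbb E\|\frac1r\mathcal C(x)-x\|^2\le(1-\omega)\|x\|^2$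 for all $x\in\mathbb R^d$, where $r\ge1$ and $\omega\in(0,1]$. **Algorithm (Com-DSZO).** Put $\Omega_\epsilon=\{(1-\epsilon)x: x\in\Omega\}$ and let $\Pi_{\Omega_\epsilon}$ be the Euclidean projection onto it. Start from $x_{i,0}\in\Omega$, $\hat x_{i,0}=b_{i,0}=0$, $q_{i,0}=\mathcal C(x_{i,0})$, and for $k=0,1,\dots$ and every $i$ let $$\begin{aligned}\hat x_{i,k+1}&=\hat x_{i,k}+\psi q_{i,k},\qquad b_{i,k+1}=b_{i,k}+\psi\Big(q_{i,k}-\sum_{j}\mathbf W_{i,j}q_{j,k}\Big),\\ x_{i,k+1}&=\Pi_{\Omega_\epsilon}\big[x_{i,k}-\gamma b_{i,k+1}-\eta_k\,g_{i,k}\big],\qquad q_{i,k+1}=\mathcal C(x_{i,k+1}-\hat x_{i,k+1}),\end{aligned}$$ where $g_{i,k}=\frac d\mu\big(F_i(x_{i,k}+\mu u_{i,k},\xi_{i,k})-F_i(x_{i,k},\xi_{i,k})\big)u_{i,k}$, with $\xi_{i,k}\sim\mathcal P_i$, $u_{i,k}$ uniform on the unit sphere, and the samples, the directions and the internal randomness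 of the compressor independent of one another and across agents and iterations. Let $\bar x_k=\frac1n\sum_{i=1}^n x_{i,k}$. **Parameters.** $\mu=1/\sqrt T$, $\epsilon=2\underline R/\sqrt T$, $\psi\in(0,1/r]$, $\eta_k=1/\sqrt{k+c}$ with $c>0$, and, with $c_0=\psi r\omega/2$, $$0<\gamma<\min\{1,\ \delta\kappa_1^{-1},\ c_0\kappa_2^{-1}\},\qquad \kappa_1=\tfrac\delta4+2(1+c_0^{-1})^2\gamma\beta^2,\qquad \kappa_2=(1+c_0^{-1})^2\gamma\beta^2+\big(1+\tfrac2\delta\big)\beta^2$$ (if $n=1$, then $\kappa_2=0$ and the last bound is void). The horizon $T\ge1$ is such that $\epsilon\le1$, and the query radius satisfies $\mu\le\epsilon\underline R$ (that is, $2\underline R^2\ge1$), so that queries made at points of $\Omega_\epsilon$ stay in $\Omega$. **Theorem.** The expectations below exist, and $$\sum_{k=1}^T\mathbb E\big[f(\bar x_k)-f(x^*)\big]\le K_1\,d^2\sqrt{T+c}+K_2\,\frac{d^2}{(\psi r\omega)^2}\Big(\sqrt{T+c}+\ln(T+c)\Big).$$ Here $K_1,K_2$ depend only on $n$, $\mathbf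 W$, $L_f$, $\underline R$, $\bar R$ and on a number $\lambda>0$ with $\gamma\ge\lambda(\psi r\omega)^2$. They do not depend on $T,d,c,\psi,r,\omega$, nor otherwise on $\gamma$ or on the problem data. (Every admissible $\gamma$ satisfies this requirement with $\lambda=\gamma$, so that it only specifies how the constants depend on $\gamma$.) -/

import Mathlib

open MeasureTheory ProbabilityTheory

universe u v w

/-- Euclidean space `ℝ^d`. -/
abbrev E (d : ℕ) : Type := EuclideanSpace ℝ (Fin d)

/-! ### Network -/

/-- Spectral norm (largest singular value) of a real square matrix. -/
noncomputable def specNorm {n : ℕ} (A : Matrix (Fin n) (Fin n) ℝ) : ℝ :=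
  ‖Matrix.toEuclideanCLM (n := Fin n) (𝕜 := ℝ) A‖

/-- The averaging matrix `H = (1/n) 1 1ᵀ`. -/
noncomputable def avgMatrix (n : ℕ) : Matrix (Fin n) (Fin n) ℝ :=
  Matrix.of fun _ _ => (1 : ℝ) / n

/-- Spectral gap `δ`, i.e. `‖W - H‖₂ = 1 - δ`. -/
noncomputable def specGap {n : ℕ} (W : Matrix (Fin n) (Fin n) ℝ) : ℝ :=
  1 - specNorm (W - avgMatrix n)

/-- `β = ‖I - W‖₂`. -/
noncomputable def lapNorm {n : ℕ} (W : Matrix (Fin n) (Fin n) ℝ) : ℝ :=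
  specNorm (1 - W)

/-- `W` is a weight matrix of the connected undirected graph `G`: it is supported on the edges
and the diagonal, symmetric, doubly stochastic, `null (I - W)` is the line of consensus vectors,
and `I + W` is positive definite. -/
structure IsWeightMatrix {n : ℕ} (G : SimpleGraph (Fin n)) (W : Matrix (Fin n) (Fin n) ℝ) :
    Prop where
  connected : G.Connected
  support : ∀ i j, W i j ≠ 0 → i = j ∨ G.Adj i j
  symm : W.IsSymm
  stochastic : W ∈ doublyStochastic ℝ (Fin n)
  consensus : LinearMap.ker (Matrix.toLin' (1 - W)) = Submodule.span ℝ {fun _ => (1 : ℝ)}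
  spectral : (1 + W).PosDef

/-! ### Constraint set -/

/-- `Om` is closed and convex, contains the ball of radius `Rlo` and lies in the ball of radius
`Rhi` (both centred at the origin). -/
structure IsConstraintSet {d : ℕ} (Om : Set (E d)) (Rlo Rhi : ℝ) : Prop where
  closed : IsClosed Om
  convex : Convex ℝ Om
  inner : Metric.closedBall 0 Rlo ⊆ Om
  outer : Om ⊆ Metric.closedBall 0 Rhi

/-- The shrunk set `Ω_ε = {(1 - ε) x | x ∈ Ω}`. -/
def shrink {d : ℕ} (Om : Set (E d)) (ε : ℝ) : Set (E d) :=
  (fun x => (1 - ε) • x) '' Om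

open Classical in
/-- Euclidean projection: a point of `S` nearest to `z` (it exists and is unique when `S` is
nonempty, closed and convex; the value is `z` if there is no nearest point). -/
noncomputable def proj {d : ℕ} (S : Set (E d)) (z : E d) : E d :=
  if h : ∃ p ∈ S, ∀ y ∈ S, ‖p - z‖ ≤ ‖y - z‖ then h.choose else z

/-! ### Stochastic objectives -/

/-- For almost every sample, the oracle `F(·, ξ)` is convex and `L`-Lipschitz on `Om`;
`F` is jointly measurable, and the expectation `E F(x, ξ)` exists for every `x ∈ Om`. -/
structure IsOracle {d : ℕ} {X : Type u} [MeasurableSpace X] (Om : Set (E d)) (L : ℝ)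
    (P : Measure X) (F : E d → X → ℝ) : Prop where
  measurable : Measurable fun p : E d × X => F p.1 p.2
  integrable : ∀ x ∈ Om, Integrable (F x) P
  convex : ∀ᵐ ξ ∂P, ConvexOn ℝ Om fun x => F x ξ
  lipschitz : ∀ᵐ ξ ∂P, ∀ x ∈ Om, ∀ y ∈ Om, |F x ξ - F y ξ| ≤ L * ‖x - y‖

/-- The global objective `f = (1/n) ∑ᵢ fᵢ`, with `fᵢ(x) = E[Fᵢ(x, ξᵢ)]`, `ξᵢ ∼ Pᵢ`. -/
noncomputable def objective {n d : ℕ} {X : Fin n → Type u} [∀ i, MeasurableSpace (X i)]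
    (P : ∀ i, Measure (X i)) (F : ∀ i, E d → X i → ℝ) (x : E d) : ℝ :=
  (1 / (n : ℝ)) * ∑ i, ∫ ξ, F i x ξ ∂(P i)

/-- The uniform probability distribution on the unit sphere of `ℝ^d` (for `1 ≤ d`). -/
noncomputable def sphereUniform (d : ℕ) : Measure (E d) :=
  (((volume : Measure (E d)).toSphere Set.univ)⁻¹ • (volume : Measure (E d)).toSphere).map
    Subtype.val

/-- Two-point gradient estimator `(d/μ) (F(x + μ u, ξ) - F(x, ξ)) u`. -/
noncomputable def gradEst {d : ℕ} {X : Type u} (F : E d → X → ℝ) (μ : ℝ) (x v : E d) (ξ : X) :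
    E d :=
  ((d : ℝ) / μ * (F (x + μ • v) ξ - F x ξ)) • v

/-! ### Compressor -/

/-- `C(x, ζ)`, with internal randomness `ζ ∼ ν`, is a compressor with scaling `r` and
compression level `ω`: `E ‖C(x, ζ) / r - x‖² ≤ (1 - ω) ‖x‖²` for all `x`. -/
structure IsCompressor {d : ℕ} {Z : Type v} [MeasurableSpace Z] (ν : Measure Z)
    (C : E d → Z → E d) (r ω : ℝ) : Prop where
  measurable : Measurable fun p : E d × Z => C p.1 p.2
  integrable : ∀ x, Integrable (fun ζ => ‖(1 / r) • C x ζ - x‖ ^ 2) ν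
  bound : ∀ x, ∫ ζ, ‖(1 / r) • C x ζ - x‖ ^ 2 ∂ν ≤ (1 - ω) * ‖x‖ ^ 2

/-! ### The algorithm -/

/-- The variables of all agents at one iteration. -/
structure State (n d : ℕ) where
  x : Fin n → E d
  xhat : Fin n → E d
  b : Fin n → E d
  q : Fin n → E d

/-- The trajectory of Com-DSZO for given samples `ξ i k`, directions `dir i k` and compressor
randomness `ζ i k` of agent `i` at iteration `k`. -/
noncomputable def comDSZO {n d : ℕ} {X : Fin n → Type u} {Z : Type v}
    (W : Matrix (Fin n) (Fin n) ℝ) (Om : Set (E d)) (F : ∀ i, E d → X i → ℝ)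
    (C : E d → Z → E d) (μ ε ψ γ : ℝ) (η : ℕ → ℝ) (x₀ : Fin n → E d)
    (ξ : ∀ i, ℕ → X i) (dir : Fin n → ℕ → E d) (ζ : Fin n → ℕ → Z) : ℕ → State n d
  | 0 =>
    { x := x₀
      xhat := fun _ => 0
      b := fun _ => 0
      q := fun i => C (x₀ i) (ζ i 0) }
  | k + 1 =>
    let s := comDSZO W Om F C μ ε ψ γ η x₀ ξ dir ζ k
    let xhat' : Fin n → E d := fun i => s.xhat i + ψ • s.q i
    let b' : Fin n → E d := fun i => s.b i + ψ • (s.q i - ∑ j, W i j • s.q j)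
    let x' : Fin n → E d := fun i =>
      proj (shrink Om ε)
        (s.x i - γ • b' i - η k • gradEst (F i) μ (s.x i) (dir i k) (ξ i k))
    { x := x'
      xhat := xhat'
      b := b'
      q := fun i => C (x' i - xhat' i) (ζ i (k + 1)) }

/-- The network average `(1/n) ∑ᵢ xᵢ`. -/
noncomputable def State.avg {n d : ℕ} (s : State n d) : E d :=
  (1 / (n : ℝ)) • ∑ i, s.x i

/-- The random inputs of the algorithm: the triples `(ξ i k, dir i k, ζ i k)` are mutually
independent over all agents `i` and iterations `k`, and within a triple `ξ i k ∼ Pᵢ`, `dir i k`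
uniform on the unit sphere, and `ζ i k ∼ ν` are independent. -/
structure IsNoise {n d : ℕ} {X : Fin n → Type u} [∀ i, MeasurableSpace (X i)] {Z : Type v}
    [MeasurableSpace Z] {S : Type w} [MeasurableSpace S] (Pr : Measure S)
    (P : ∀ i, Measure (X i)) (ν : Measure Z)
    (ξ : ∀ i, ℕ → S → X i) (dir : Fin n → ℕ → S → E d) (ζ : Fin n → ℕ → S → Z) : Prop where
  measurable : ∀ i k, Measurable fun s => (ξ i k s, dir i k s, ζ i k s)
  law : ∀ i k, HasLaw (fun s => (ξ i k s, dir i k s, ζ i k s))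
    ((P i).prod ((sphereUniform d).prod ν)) Pr
  indep : iIndepFun (β := fun p : Fin n × ℕ => X p.1 × E d × Z)
    (fun p s => (ξ p.1 p.2 s, dir p.1 p.2 s, ζ p.1 p.2 s)) Pr

/-! ### Admissible gossip step -/

/-- `κ₁ = δ/4 + 2 (1 + c₀⁻¹)² γ β²`. -/
noncomputable def kappa1 (δ β c₀ γ : ℝ) : ℝ := δ / 4 + 2 * (1 + c₀⁻¹) ^ 2 * γ * β ^ 2

/-- `κ₂ = (1 + c₀⁻¹)² γ β² + (1 + 2/δ) β²`. -/
noncomputable def kappa2 (δ β c₀ γ : ℝ) : ℝ :=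
  (1 + c₀⁻¹) ^ 2 * γ * β ^ 2 + (1 + 2 / δ) * β ^ 2

/-- `0 < γ < min {1, δ/κ₁, c₀/κ₂}`, written without division, so that `c₀/κ₂` counts as `+∞` in
the one-agent case, where `β = 0` and hence `κ₂ = 0`. -/
def IsGossipStep (δ β c₀ γ : ℝ) : Prop :=
  0 < γ ∧ γ < 1 ∧ γ * kappa1 δ β c₀ γ < δ ∧ γ * kappa2 δ β c₀ γ < c₀

/-! ### Euclidean projection -/

section Projection

variable {d : ℕ} {S : Set (E d)}

/-! Stack the agents' vectors into `X` and the compressed estimates into `X̂`. Since `b = (I - W)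
X̂` at all times (`run_b`), a step reads `X' = Π[X - γ (I - W) X̂' - η g]`: a projected gradient
step perturbed by gossip on inexact copies.

Two `L²` errors are tracked: the deviation `x` of `X` from consensus and the compression error `e`
of `X - X̂`. The projection is nonexpansive, `I - γ (I - W)` contracts deviations by `1 - γδ`, and
one compressor call shrinks `e` by `1 - c₀`. This yields a two-dimensional linear recursion forced
by `η √n d L`. The bound on `γ κ₂` makes a combination `v = p x + q e` contract at a rate `ρ`
proportional to `γ` (`exists_lyapunov_weights`), and `sum_sq_div_le` then bounds `ρ ∑ v²/η`.

In the descent inequality for the squared distance to `(1 - ε) x*`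
(`norm_sq_step_sub_consensus_le`), gossip costs only `γ` times a multiple of `x² + e²`, because
consensus vectors are orthogonal to the range of `I - W`. Dividing by `2η` and summing, this cost is
of order `γ ∑ v²/η`; its `γ` matches `ρ`, so it is of order `(1/c₀² + d²/γ) √(T+c)`, and `γ ≥ λ
(ψrω)²` gives the claimed form. The argument produces no logarithm; that term is nonnegative and is
added at the end.

The gradient enters through `sphere_estimator_subgradient`: in expectation the estimator is the
gradient of a ball average of `F`, hence a subgradient up to `2Lμ`. Without smoothness, this is
proved by testing convexity against a radial cutoff of the ball, moving the difference quotient onto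
the cutoff and letting its boundary layer shrink. Independence from the past transfers the bound to
the random iterates (`linearized_regret_ge`).

The starting point lies only in `Ω`, so queries at iteration 0 may leave it. Gradient bounds
therefore start at `k = 1`; boundedness of `Ω` covers the first step. -/

theorem proj_spec (hne : S.Nonempty) (hc : IsClosed S) (z : E d) :
    proj S z ∈ S ∧ ∀ y ∈ S, ‖proj S z - z‖ ≤ ‖y - z‖ := by
  have h : ∃ p ∈ S, ∀ y ∈ S, ‖p - z‖ ≤ ‖y - z‖ := by
    obtain ⟨p, hp, hpz⟩ := hc.exists_infDist_eq_dist hne z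
    refine ⟨p, hp, fun y hy => ?_⟩
    rw [← dist_eq_norm, ← dist_eq_norm, dist_comm p, dist_comm y, ← hpz]
    exact Metric.infDist_le_dist_of_mem hy
  rw [proj, dif_pos h]
  exact h.choose_spec

theorem proj_inner_le (hne : S.Nonempty) (hc : IsClosed S) (hv : Convex ℝ S) (z : E d)
    {y : E d} (hy : y ∈ S) : inner ℝ (z - proj S z) (y - proj S z) ≤ 0 := by
  obtain ⟨hp, hmin⟩ := proj_spec hne hc z
  refine (norm_eq_iInf_iff_real_inner_le_zero hv hp).1 (le_antisymm ?_ ?_) y hy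
  · have : Nonempty S := ⟨⟨_, hp⟩⟩
    exact le_ciInf fun w => by
      rw [norm_sub_rev, norm_sub_rev z]; exact hmin w w.2
  · exact ciInf_le ⟨0, Set.forall_mem_range.2 fun _ => norm_nonneg _⟩ (⟨_, hp⟩ : S)

/-- Adding the variational inequalities of the two projections gives firm nonexpansiveness;
Cauchy–Schwarz does the rest. -/
theorem norm_proj_sub_proj_le (hne : S.Nonempty) (hc : IsClosed S) (hv : Convex ℝ S) (z w : E d) :
    ‖proj S z - proj S w‖ ≤ ‖z - w‖ := by
  have h1 := proj_inner_le hne hc hv z (proj_spec hne hc w).1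
  have h2 := proj_inner_le hne hc hv w (proj_spec hne hc z).1
  have h3 : ‖proj S z - proj S w‖ ^ 2 ≤ inner ℝ (z - w) (proj S z - proj S w) := by
    rw [← real_inner_self_eq_norm_sq]
    simp only [inner_sub_left, inner_sub_right, real_inner_comm] at *
    linarith
  have h4 := real_inner_le_norm (z - w) (proj S z - proj S w)
  by_contra! h
  nlinarith [norm_nonneg (z - w), norm_nonneg (proj S z - proj S w)]

theorem proj_of_mem (hne : S.Nonempty) (hc : IsClosed S) {y : E d} (hy : y ∈ S) :
    proj S y = y := by
  have h := (proj_spec hne hc y).2 y hy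
  simpa [sub_eq_zero] using h

theorem norm_proj_sub_le (hne : S.Nonempty) (hc : IsClosed S) (hv : Convex ℝ S) (z : E d)
    {y : E d} (hy : y ∈ S) : ‖proj S z - y‖ ≤ ‖z - y‖ := by
  simpa [proj_of_mem hne hc hy] using norm_proj_sub_proj_le hne hc hv z y

theorem continuous_proj (hne : S.Nonempty) (hc : IsClosed S) (hv : Convex ℝ S) :
    Continuous (proj S) :=
  (LipschitzWith.of_dist_le_mul (K := 1) fun z w => by
    simpa [dist_eq_norm] using norm_proj_sub_proj_le hne hc hv z w).continuous

end Projection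

/-! ### The shrunk constraint set -/

section Shrink

variable {d : ℕ} {Om : Set (E d)} {Rlo Rhi ε : ℝ}

theorem IsConstraintSet.norm_le (h : IsConstraintSet Om Rlo Rhi) {x : E d} (hx : x ∈ Om) :
    ‖x‖ ≤ Rhi := by
  simpa using h.outer hx

theorem IsConstraintSet.zero_mem (h : IsConstraintSet Om Rlo Rhi) (hR : 0 < Rlo) :
    (0 : E d) ∈ Om :=
  h.inner (by simpa using hR.le)

theorem IsConstraintSet.shrink_nonempty (h : IsConstraintSet Om Rlo Rhi) (hR : 0 < Rlo) :
    (shrink Om ε).Nonempty :=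
  ⟨_, Set.mem_image_of_mem _ (h.zero_mem hR)⟩

/-- Compactness of `Om` makes this work for every `ε`, including `ε = 1`. -/
theorem IsConstraintSet.shrink_isClosed (h : IsConstraintSet Om Rlo Rhi) :
    IsClosed (shrink Om ε) := by
  have : IsCompact Om := (isCompact_closedBall 0 Rhi).of_isClosed_subset h.closed h.outer
  exact (this.image (continuous_const_smul (1 - ε))).isClosed

theorem IsConstraintSet.shrink_convex (h : IsConstraintSet Om Rlo Rhi) :
    Convex ℝ (shrink Om ε) := by
  simpa [shrink, Set.image_smul] using h.convex.smul (1 - ε)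

/-- The point `(1 - ε) z + v` is the convex combination of `z` and `v / ε`, and the latter lies in
the inner ball. -/
theorem IsConstraintSet.add_mem_of_mem_shrink (h : IsConstraintSet Om Rlo Rhi) (hε : 0 < ε)
    (hε1 : ε ≤ 1) {x v : E d} (hx : x ∈ shrink Om ε) (hv : ‖v‖ ≤ ε * Rlo) : x + v ∈ Om := by
  obtain ⟨z, hz, rfl⟩ := hx
  have hv' : ε⁻¹ • v ∈ Om := h.inner (by
    rw [mem_closedBall_zero_iff, norm_smul, norm_inv, Real.norm_of_nonneg hε.le]
    rw [inv_mul_le_iff₀ hε]; exact hv)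
  have := h.convex hz hv' (sub_nonneg.2 hε1) hε.le (by ring)
  simpa [smul_smul, hε.ne'] using this

theorem IsConstraintSet.shrink_subset (h : IsConstraintSet Om Rlo Rhi) (hR : 0 < Rlo)
    (hε : 0 < ε) (hε1 : ε ≤ 1) : shrink Om ε ⊆ Om := fun x hx => by
  simpa using h.add_mem_of_mem_shrink hε hε1 hx (v := 0) (by simpa using (mul_pos hε hR).le)

end Shrink

/-! ### Mixing the vectors of the agents -/

/-- The vectors of all agents, with the Frobenius norm. -/
abbrev Stack (n d : ℕ) : Type := PiLp 2 fun _ : Fin n => E d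

section Mixing

variable {n d : ℕ}

/-- Mixing with the matrix `A`, i.e. the product `A X` with the rows of `X` the agents' vectors. -/
noncomputable def mix (A : Matrix (Fin n) (Fin n) ℝ) : Stack n d →ₗ[ℝ] Stack n d where
  toFun X := WithLp.toLp 2 fun i => ∑ j, A i j • X j
  map_add' X Y := by ext i : 1; simp [smul_add, Finset.sum_add_distrib]
  map_smul' a X := by ext i : 1; simp [Finset.smul_sum, smul_comm a]

@[simp] theorem mix_apply (A : Matrix (Fin n) (Fin n) ℝ) (X : Stack n d) (i : Fin n) :
    mix A X i = ∑ j, A i j • X j := rfl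

theorem mix_sub (A B : Matrix (Fin n) (Fin n) ℝ) (X : Stack n d) :
    mix (A - B) X = mix A X - mix B X := by
  ext i : 1; simp [sub_smul, Finset.sum_sub_distrib]

theorem mix_one (X : Stack n d) : mix 1 X = X := by
  ext i : 1; simp [Matrix.one_apply]

theorem specNorm_nonneg (A : Matrix (Fin n) (Fin n) ℝ) : 0 ≤ specNorm A := norm_nonneg _

/-- The spectral norm controls mixing in the Frobenius norm. -/
theorem norm_mix_le (A : Matrix (Fin n) (Fin n) ℝ) (X : Stack n d) :
    ‖mix A X‖ ≤ specNorm A * ‖X‖ := by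
  -- The squared Frobenius norm splits over the coordinates `l`, and mixing acts on each coordinate
  -- column as the matrix `A` on `ℝⁿ`.
  have key : ∀ Y : Stack n d,
      ‖Y‖ ^ 2 = ∑ l, ‖(WithLp.toLp 2 fun i => Y i l : EuclideanSpace ℝ (Fin n))‖ ^ 2 := by
    intro Y
    simp only [PiLp.norm_sq_eq_of_L2]
    rw [Finset.sum_comm]
  refine le_of_sq_le_sq ?_ (mul_nonneg (specNorm_nonneg A) (norm_nonneg X))
  rw [mul_pow, key, key X, Finset.mul_sum]
  refine Finset.sum_le_sum fun l _ => ?_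
  rw [← mul_pow]
  refine pow_le_pow_left₀ (norm_nonneg _) ?_ 2
  have h : (WithLp.toLp 2 fun i => mix A X i l : EuclideanSpace ℝ (Fin n))
      = Matrix.toEuclideanCLM (n := Fin n) (𝕜 := ℝ) A (WithLp.toLp 2 fun i => X i l) := by
    ext i
    simp [Matrix.mulVec, dotProduct]
  rw [h]
  exact (Matrix.toEuclideanCLM (n := Fin n) (𝕜 := ℝ) A).le_opNorm _

/-- The consensus stack with all vectors equal to `x`. -/
def consensusStack (n : ℕ) (x : E d) : Stack n d := WithLp.toLp 2 fun _ => x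

@[simp] theorem consensusStack_apply (x : E d) (i : Fin n) : consensusStack n x i = x := rfl

/-- The average of the vectors of a stack. -/
noncomputable def stackAvg (X : Stack n d) : E d := (1 / (n : ℝ)) • ∑ i, X i

/-- The deviation of a stack from consensus. -/
noncomputable def deviation (X : Stack n d) : Stack n d := X - consensusStack n (stackAvg X)

theorem sum_deviation (X : Stack n d) : ∑ i, deviation X i = 0 := by
  rcases Nat.eq_zero_or_pos n with rfl | hn
  · simp
  · have : (n : ℝ) ≠ 0 := by positivity
    simp [deviation, stackAvg, Finset.sum_sub_distrib, ← Nat.cast_smul_eq_nsmul ℝ, smul_smul, this]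

theorem inner_consensus_deviation (x : E d) (X : Stack n d) :
    inner ℝ (consensusStack n x) (deviation X) = 0 := by
  rw [PiLp.inner_apply]
  simp only [consensusStack_apply]
  rw [← inner_sum, sum_deviation, inner_zero_right]

/-- The average is the nearest consensus. -/
theorem norm_deviation_le (X : Stack n d) (x : E d) : ‖deviation X‖ ≤ ‖X - consensusStack n x‖ := by
  have h : X - consensusStack n x = deviation X + consensusStack n (stackAvg X - x) := by
    ext i : 1; simp [deviation]
  refine le_of_sq_le_sq ?_ (norm_nonneg _)
  rw [h, norm_add_sq_real, real_inner_comm, inner_consensus_deviation]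
  nlinarith [sq_nonneg ‖consensusStack n (stackAvg X - x)‖]

variable {G : SimpleGraph (Fin n)} {W : Matrix (Fin n) (Fin n) ℝ}

theorem IsWeightMatrix.pos (hW : IsWeightMatrix G W) : 0 < n :=
  Fin.pos_iff_nonempty.2 hW.connected.nonempty

theorem IsWeightMatrix.mix_consensus (hW : IsWeightMatrix G W) (x : E d) :
    mix (1 - W) (consensusStack n x) = 0 := by
  ext i : 1
  have h := (mem_doublyStochastic_iff_sum.1 hW.stochastic).2.1 i
  rw [mix_sub, mix_one]
  simp [← Finset.sum_smul, h]

theorem IsWeightMatrix.mix_deviation (hW : IsWeightMatrix G W) (X : Stack n d) :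
    mix (1 - W) (deviation X) = mix (1 - W) X := by
  rw [deviation, map_sub, hW.mix_consensus, sub_zero]

theorem IsWeightMatrix.sum_mix (hW : IsWeightMatrix G W) (X : Stack n d) :
    ∑ i, mix (1 - W) X i = 0 := by
  have h := (mem_doublyStochastic_iff_sum.1 hW.stochastic).2.2
  rw [mix_sub, mix_one]
  simp only [PiLp.sub_apply, mix_apply, Finset.sum_sub_distrib]
  rw [Finset.sum_comm]
  simp [← Finset.sum_smul, h]

theorem IsWeightMatrix.inner_consensus_mix (hW : IsWeightMatrix G W) (x : E d) (X : Stack n d) :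
    inner ℝ (consensusStack n x) (mix (1 - W) X) = 0 := by
  rw [PiLp.inner_apply]
  simp only [consensusStack_apply]
  rw [← inner_sum, hW.sum_mix, inner_zero_right]

theorem mix_avgMatrix_deviation (X : Stack n d) : mix (avgMatrix n) (deviation X) = 0 := by
  ext i : 1
  simp only [mix_apply, avgMatrix, Matrix.of_apply, ← Finset.smul_sum, sum_deviation]
  simp

/-- Averaging kills deviations, so on them `W` acts as `W - H`, whose norm is `1 - δ`. -/
theorem norm_mix_deviation_le (X : Stack n d) :
    ‖mix W (deviation X)‖ ≤ (1 - specGap W) * ‖deviation X‖ := by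
  have : mix W (deviation X) = mix (W - avgMatrix n) (deviation X) := by
    rw [mix_sub, mix_avgMatrix_deviation, sub_zero]
  rw [this, specGap, sub_sub_cancel]
  exact norm_mix_le _ _

theorem specGap_le_one : specGap W ≤ 1 := by
  have := specNorm_nonneg (W - avgMatrix n)
  unfold specGap; linarith

theorem lapNorm_nonneg : 0 ≤ lapNorm W := specNorm_nonneg _

/-- The form is at least `δ ‖D‖²`, by Cauchy–Schwarz and the contraction of `W` on deviations. -/
theorem inner_deviation_mix_nonneg (hδ : 0 ≤ specGap W)
    (X : Stack n d) : 0 ≤ inner ℝ (deviation X) (mix (1 - W) (deviation X)) := by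
  rw [mix_sub, mix_one, inner_sub_right, real_inner_self_eq_norm_sq]
  have h1 := real_inner_le_norm (deviation X) (mix W (deviation X))
  have h2 := norm_mix_deviation_le (W := W) X
  nlinarith [norm_nonneg (deviation X)]

/-- The gossip operator `I - γ (I - W)` contracts deviations from consensus. -/
theorem norm_gossip_deviation_le {γ : ℝ} (hγ : 0 ≤ γ) (hγ1 : γ ≤ 1) (X : Stack n d) :
    ‖deviation X - γ • mix (1 - W) (deviation X)‖ ≤ (1 - γ * specGap W) * ‖deviation X‖ := by
  have h : deviation X - γ • mix (1 - W) (deviation X)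
      = (1 - γ) • deviation X + γ • mix W (deviation X) := by
    rw [mix_sub, mix_one]; module
  rw [h]
  refine (norm_add_le _ _).trans ?_
  rw [norm_smul, norm_smul, Real.norm_of_nonneg hγ, Real.norm_of_nonneg (sub_nonneg.2 hγ1)]
  nlinarith [norm_mix_deviation_le (W := W) X]

/-- Unless `I = W`, the spectral gap is at most the norm of the Laplacian. -/
theorem IsWeightMatrix.specGap_le_lapNorm (hW : IsWeightMatrix G W) (hβ : lapNorm W ≠ 0) :
    specGap W ≤ lapNorm W := by
  -- Scalar stacks suffice: the indicator of agent `j` reads off column `j` of `1 - W`.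
  obtain ⟨y, hy⟩ : ∃ y : Stack n 1, mix (1 - W) y ≠ 0 := by
    by_contra! h
    refine hβ ?_
    have : (1 : Matrix (Fin n) (Fin n) ℝ) - W = 0 := by
      ext i j
      have := congrArg (fun Y : Stack n 1 => Y i 0)
        (h (WithLp.toLp 2 fun k => if k = j then WithLp.toLp 2 (fun _ => 1) else 0))
      simpa [Finset.sum_apply, apply_ite, ite_apply] using this
    rw [lapNorm, specNorm, this, map_zero, norm_zero]
  -- A vector in the range of `1 - W` has average zero, so it is its own deviation; `W` shrinks it
  -- by `1 - δ`, whence `‖(1 - W) z‖ ≥ δ ‖z‖`.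
  set z := mix (1 - W) y
  have hz : deviation z = z := by
    have : stackAvg z = 0 := by rw [stackAvg, hW.sum_mix, smul_zero]
    ext i : 1; simp [deviation, this]
  have hz0 : 0 < ‖z‖ := norm_pos_iff.2 hy
  have h1 := norm_mix_le (1 - W) z
  have h2 := norm_mix_deviation_le (W := W) z
  rw [hz] at h2
  rw [mix_sub, mix_one] at h1
  have h3 := norm_sub_norm_le z (mix W z)
  have : specGap W * ‖z‖ ≤ lapNorm W * ‖z‖ := by rw [lapNorm]; linarith
  exact le_of_mul_le_mul_right this hz0

/-! ### One step of the algorithm -/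

variable {S : Set (E d)} {γ η : ℝ} {X V g X' : Stack n d}

theorem stack_norm_le_of_forall {X Y : Stack n d} (h : ∀ i, ‖X i‖ ≤ ‖Y i‖) : ‖X‖ ≤ ‖Y‖ := by
  refine le_of_sq_le_sq ?_ (norm_nonneg _)
  rw [PiLp.norm_sq_eq_of_L2, PiLp.norm_sq_eq_of_L2]
  exact Finset.sum_le_sum fun i _ => pow_le_pow_left₀ (norm_nonneg _) (h i) 2

theorem norm_mix_laplacian_le (hW : IsWeightMatrix G W) (X V : Stack n d) :
    ‖mix (1 - W) V‖ ≤ lapNorm W * (‖deviation X‖ + ‖X - V‖) := by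
  have : mix (1 - W) V = mix (1 - W) (deviation X) - mix (1 - W) (X - V) := by
    rw [hW.mix_deviation, map_sub]; abel
  rw [this, mul_add]
  exact (norm_sub_le _ _).trans (add_le_add (norm_mix_le _ _) (norm_mix_le _ _))

/-- By convexity the average of `X` lies in `S`, so projecting does not increase the distance to
that consensus, which in turn dominates the new deviation. Gossiping with `V` in place of `X` adds
the perturbation `γ (1 - W) (X - V)`. -/
theorem norm_deviation_step_le (hW : IsWeightMatrix G W) (hne : S.Nonempty)
    (hc : IsClosed S) (hv : Convex ℝ S) (hX : ∀ i, X i ∈ S)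
    (hX' : ∀ i, X' i = proj S (X i - γ • mix (1 - W) V i - η • g i))
    (hγ : 0 ≤ γ) (hγ1 : γ ≤ 1) (hη : 0 ≤ η) :
    ‖deviation X'‖ ≤ (1 - γ * specGap W) * ‖deviation X‖ + γ * lapNorm W * ‖X - V‖
      + η * ‖g‖ := by
  have hn := hW.pos
  have havg : stackAvg X ∈ S := by
    have := hv.sum_mem (t := Finset.univ) (w := fun _ : Fin n => 1 / (n : ℝ)) (z := fun i => X i)
      (fun _ _ => by positivity) (by simp [hn.ne']) (fun i _ => hX i)
    rwa [← Finset.smul_sum] at this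
  have h1 : ‖deviation X'‖
      ≤ ‖X - γ • mix (1 - W) V - η • g - consensusStack n (stackAvg X)‖ := by
    refine (norm_deviation_le X' (stackAvg X)).trans (stack_norm_le_of_forall fun i => ?_)
    have := norm_proj_sub_le hne hc hv (X i - γ • mix (1 - W) V i - η • g i) havg
    rw [← hX'] at this
    exact this
  have h2 : X - γ • mix (1 - W) V - η • g - consensusStack n (stackAvg X)
      = (deviation X - γ • mix (1 - W) (deviation X)) + γ • mix (1 - W) (X - V) - η • g := by
    rw [hW.mix_deviation, map_sub, deviation]; module
  rw [h2] at h1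
  refine h1.trans ((norm_sub_le _ _).trans (add_le_add ((norm_add_le _ _).trans
    (add_le_add (norm_gossip_deviation_le hγ hγ1 X) ?_)) ?_))
  · rw [norm_smul, Real.norm_of_nonneg hγ, mul_assoc]
    exact mul_le_mul_of_nonneg_left (norm_mix_le _ _) hγ
  · rw [norm_smul, Real.norm_of_nonneg hη]

theorem norm_step_sub_le (hW : IsWeightMatrix G W) (hne : S.Nonempty)
    (hc : IsClosed S) (hv : Convex ℝ S) (hX : ∀ i, X i ∈ S)
    (hX' : ∀ i, X' i = proj S (X i - γ • mix (1 - W) V i - η • g i))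
    (hγ : 0 ≤ γ) (hη : 0 ≤ η) :
    ‖X' - X‖ ≤ γ * lapNorm W * (‖deviation X‖ + ‖X - V‖) + η * ‖g‖ := by
  have h1 : ‖X' - X‖ ≤ ‖-(γ • mix (1 - W) V + η • g)‖ := by
    refine stack_norm_le_of_forall fun i => ?_
    have := norm_proj_sub_le hne hc hv (X i - γ • mix (1 - W) V i - η • g i) (hX i)
    rw [← hX'] at this
    refine this.trans_eq ?_
    congr 1
    simp only [PiLp.neg_apply, PiLp.add_apply, PiLp.smul_apply]
    abel
  rw [norm_neg] at h1
  refine h1.trans ((norm_add_le _ _).trans (add_le_add ?_ ?_))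
  · rw [norm_smul, Real.norm_of_nonneg hγ, mul_assoc]
    exact mul_le_mul_of_nonneg_left (norm_mix_laplacian_le hW X V) hγ
  · rw [norm_smul, Real.norm_of_nonneg hη]

/-- In the cross term of `Y = X - x` with `b = (1 - W) V`, the consensus part of `Y` drops out, and
the part of `b` coming from the deviation `D` contributes nonnegatively. Only `-β ‖D‖ ‖R‖` can be
lost. -/
theorem norm_sq_step_sub_consensus_le (hW : IsWeightMatrix G W) (hne : S.Nonempty)
    (hc : IsClosed S) (hv : Convex ℝ S) 
    (hX' : ∀ i, X' i = proj S (X i - γ • mix (1 - W) V i - η • g i))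
    (hδ : 0 ≤ specGap W) (hγ : 0 ≤ γ) (hγ1 : γ ≤ 1)
    {x : E d} (hx : x ∈ S) :
    ‖X' - consensusStack n x‖ ^ 2 ≤ ‖X - consensusStack n x‖ ^ 2
      + γ * (lapNorm W * (1 + 4 * lapNorm W)) * (‖deviation X‖ ^ 2 + ‖X - V‖ ^ 2)
      + 2 * η ^ 2 * ‖g‖ ^ 2 - 2 * η * inner ℝ (X - consensusStack n x) g := by
  set β := lapNorm W
  set D := deviation X
  set R := X - V
  set b := mix (1 - W) V
  set Y := X - consensusStack n x
  have h1 : ‖X' - consensusStack n x‖ ≤ ‖Y - (γ • b + η • g)‖ := by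
    refine stack_norm_le_of_forall fun i => ?_
    have := norm_proj_sub_le hne hc hv (X i - γ • b i - η • g i) hx
    rw [← hX'] at this
    refine this.trans_eq ?_
    congr 1
    simp only [Y, PiLp.sub_apply, PiLp.add_apply, PiLp.smul_apply, consensusStack_apply]
    abel
  have h2 : ‖X' - consensusStack n x‖ ^ 2 ≤ ‖Y - (γ • b + η • g)‖ ^ 2 :=
    pow_le_pow_left₀ (norm_nonneg _) h1 2
  have hb : b = mix (1 - W) D - mix (1 - W) R := by
    rw [hW.mix_deviation, map_sub]; simp [b]
  have hY : Y = D + consensusStack n (stackAvg X - x) := by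
    ext i : 1; simp [Y, D, deviation]
  have hYb : -(β * ‖D‖ * ‖R‖) ≤ inner ℝ Y b := by
    rw [hY, inner_add_left, hW.inner_consensus_mix, add_zero, hb, inner_sub_right]
    have h3 := inner_deviation_mix_nonneg hδ X
    have h4 := real_inner_le_norm D (mix (1 - W) R)
    have h5 : ‖D‖ * ‖mix (1 - W) R‖ ≤ ‖D‖ * (β * ‖R‖) :=
      mul_le_mul_of_nonneg_left (norm_mix_le _ _) (norm_nonneg _)
    linarith
  have hb2 : ‖b‖ ^ 2 ≤ β ^ 2 * (2 * (‖D‖ ^ 2 + ‖R‖ ^ 2)) := by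
    have := pow_le_pow_left₀ (norm_nonneg _) (norm_mix_laplacian_le hW X V) 2
    rw [mul_pow] at this
    refine this.trans (mul_le_mul_of_nonneg_left ?_ (sq_nonneg _))
    nlinarith [sq_nonneg (‖D‖ - ‖R‖)]
  have h6 : ‖γ • b + η • g‖ ^ 2 ≤ 2 * (γ ^ 2 * ‖b‖ ^ 2 + η ^ 2 * ‖g‖ ^ 2) := by
    have := pow_le_pow_left₀ (norm_nonneg _) (norm_add_le (γ • b) (η • g)) 2
    rw [norm_smul, norm_smul, Real.norm_of_nonneg hγ] at this
    have h8 : (‖η‖ * ‖g‖) ^ 2 = η ^ 2 * ‖g‖ ^ 2 := by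
      rw [mul_pow, Real.norm_eq_abs, sq_abs]
    nlinarith [sq_nonneg (γ * ‖b‖ - ‖η‖ * ‖g‖)]
  rw [norm_sub_sq_real Y, inner_add_right, inner_smul_right, inner_smul_right] at h2
  -- Weakening `γ²` to `γ` merges the quadratic gossip term (`4β²`) with the cross term (`β`) under
  -- a single factor `γ`.
  have hγ2 : γ ^ 2 * ‖b‖ ^ 2 ≤ γ * (β ^ 2 * (2 * (‖D‖ ^ 2 + ‖R‖ ^ 2))) := by
    have h7 : γ ^ 2 ≤ γ := by nlinarith
    exact (mul_le_mul_of_nonneg_right h7 (sq_nonneg _)).trans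
      (mul_le_mul_of_nonneg_left hb2 hγ)
  have hβ : 0 ≤ β := lapNorm_nonneg
  have h9 : γ * -(β * ‖D‖ * ‖R‖) ≤ γ * inner ℝ Y b := mul_le_mul_of_nonneg_left hYb hγ
  have h10 : γ * β * (2 * ‖D‖ * ‖R‖) ≤ γ * β * (‖D‖ ^ 2 + ‖R‖ ^ 2) :=
    mul_le_mul_of_nonneg_left (two_mul_le_add_sq _ _) (mul_nonneg hγ hβ)
  nlinarith

end Mixing

/-! ### Scalar recursions -/

/-- Summation by parts with the nondecreasing weights `1 / η k`. Keeping the slack `M - a (T + 1)`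
on the right is what lets the induction pass to the next, larger weight. -/
theorem sum_sub_div_le {a η : ℕ → ℝ} {M : ℝ} (hη : ∀ k, 0 < η k) (hanti : Antitone η)
    (haM : ∀ k, 1 ≤ k → a k ≤ M) (T : ℕ) :
    ∑ k ∈ Finset.Icc 1 T, (a k - a (k + 1)) / η k ≤ (M - a (T + 1)) / η T := by
  induction T with
  | zero => simpa using div_nonneg (sub_nonneg.2 (haM 1 le_rfl)) (hη 0).le
  | succ T ih =>
    rw [Finset.sum_Icc_succ_top (by omega)]
    have h1 : (M - a (T + 1)) / η T ≤ (M - a (T + 1)) / η (T + 1) :=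
      div_le_div_of_nonneg_left (sub_nonneg.2 (haM _ (by omega))) (hη _) (hanti (Nat.le_succ T))
    calc _ ≤ (M - a (T + 1)) / η (T + 1) + (a (T + 1) - a (T + 1 + 1)) / η (T + 1) := by
          gcongr; exact ih.trans h1
      _ = _ := by ring

theorem sum_one_div_sqrt_le {c : ℝ} (hc : 0 < c) (T : ℕ) :
    ∑ k ∈ Finset.Icc 1 T, 1 / √((k : ℝ) + c) ≤ 2 * √((T : ℝ) + c) := by
  induction T with
  | zero => simp
  | succ T ih =>
    rw [Finset.sum_Icc_succ_top (by omega)]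
    have h1 : 0 < √((T : ℝ) + c) := Real.sqrt_pos.2 (by positivity)
    have h2 : 0 < √(((T + 1 : ℕ) : ℝ) + c) := Real.sqrt_pos.2 (by positivity)
    have h3 : √((T : ℝ) + c) ^ 2 = T + c := Real.sq_sqrt (by positivity)
    have h4 : √(((T + 1 : ℕ) : ℝ) + c) ^ 2 = T + 1 + c := by
      rw [Real.sq_sqrt (by positivity)]; push_cast; ring
    have h5 : 1 / √(((T + 1 : ℕ) : ℝ) + c)
        ≤ 2 * √(((T + 1 : ℕ) : ℝ) + c) - 2 * √((T : ℝ) + c) := by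
      rw [div_le_iff₀ h2]
      nlinarith [sq_nonneg (√(((T + 1 : ℕ) : ℝ) + c) - √((T : ℝ) + c))]
    linarith

/-- Convexity of the square, with `b η = ρ (b η / ρ)`, turns the recursion into `ρ v² ≤ v² - v'² +
b² η² / ρ`. Dividing by `η` and telescoping costs only `M² / η T`. -/
theorem sum_sq_div_le {v η : ℕ → ℝ} {ρ b M : ℝ} (hη : ∀ k, 0 < η k) (hanti : Antitone η)
    (hρ : 0 < ρ) (hρ1 : ρ ≤ 1) (hv : ∀ k, 0 ≤ v k) (hvM : ∀ k, 1 ≤ k → v k ≤ M)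
    (hrec : ∀ k, 1 ≤ k → v (k + 1) ≤ (1 - ρ) * v k + b * η k) (T : ℕ) :
    ρ * ∑ k ∈ Finset.Icc 1 T, v k ^ 2 / η k
      ≤ M ^ 2 / η T + b ^ 2 / ρ * ∑ k ∈ Finset.Icc 1 T, η k := by
  have hstep : ∀ k ∈ Finset.Icc 1 T,
      ρ * (v k ^ 2 / η k) ≤ (v k ^ 2 - v (k + 1) ^ 2) / η k + b ^ 2 / ρ * η k := by
    intro k hk
    have h1 := pow_le_pow_left₀ (hv _) (hrec k (Finset.mem_Icc.1 hk).1) 2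
    have h2 : ((1 - ρ) * v k + b * η k) ^ 2 ≤ (1 - ρ) * v k ^ 2 + b ^ 2 / ρ * η k ^ 2 := by
      have : (1 - ρ) * v k ^ 2 + b ^ 2 / ρ * η k ^ 2 - ((1 - ρ) * v k + b * η k) ^ 2
          = (1 - ρ) * ρ * (v k - b * η k / ρ) ^ 2 := by
        field_simp; ring
      have h3 : 0 ≤ (1 - ρ) * ρ * (v k - b * η k / ρ) ^ 2 :=
        mul_nonneg (mul_nonneg (by linarith) hρ.le) (sq_nonneg _)
      linarith
    have h4 : ρ * v k ^ 2 ≤ v k ^ 2 - v (k + 1) ^ 2 + b ^ 2 / ρ * η k ^ 2 := by linarith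
    calc ρ * (v k ^ 2 / η k) = ρ * v k ^ 2 / η k := by ring
      _ ≤ (v k ^ 2 - v (k + 1) ^ 2 + b ^ 2 / ρ * η k ^ 2) / η k :=
        div_le_div_of_nonneg_right h4 (hη k).le
      _ = _ := by have := (hη k).ne'; field_simp
  rw [Finset.mul_sum]
  refine (Finset.sum_le_sum hstep).trans ?_
  rw [Finset.sum_add_distrib, ← Finset.mul_sum]
  gcongr
  refine (sum_sub_div_le (a := fun k => v k ^ 2) hη hanti
    (fun k hk => pow_le_pow_left₀ (hv k) (hvM k hk) 2) T).trans ?_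
  exact div_le_div_of_nonneg_right (by nlinarith [sq_nonneg (v (T + 1))]) (hη T).le

/-! ### Lyapunov function and deterministic regret bound. -/

theorem IsGossipStep.specGap_pos {δ β c₀ γ : ℝ} (h : IsGossipStep δ β c₀ γ) : 0 < δ := by
  obtain ⟨h0, h1, h2, -⟩ := h
  rw [kappa1] at h2
  have : 0 ≤ γ * (2 * (1 + c₀⁻¹) ^ 2 * γ * β ^ 2) := by positivity
  nlinarith

/-- Weights of a linear Lyapunov function for the coupled recursion of the consensus error and
the compression error, contracting at a rate proportional to the gossip step. -/
theorem exists_lyapunov_weights {δ β : ℝ} (hδ : 0 < δ) (hδ1 : δ ≤ 1) (hβ : 0 ≤ β)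
    (hδβ : β ≠ 0 → δ ≤ β) :
    ∃ p q : ℝ, 0 < p ∧ 0 ≤ q ∧ (β ≠ 0 → 0 < q) ∧ ∀ c₀ γ : ℝ, 0 < c₀ → c₀ ≤ 1 / 2 →
      IsGossipStep δ β c₀ γ → ∀ x e x' e' t : ℝ, 0 ≤ x → 0 ≤ e →
      x' ≤ (1 - γ * δ) * x + γ * β * ((1 - c₀) * e) + t →
      e' ≤ γ * β * x + (1 + γ * β) * ((1 - c₀) * e) + t →
      p * x' + q * e' ≤ (1 - γ * δ ^ 2 / 6) * (p * x + q * e) + (p + q) * t := by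
  -- For `β = 0` the compression error does not feed into `x`, and `δ ≤ β` is unavailable; `x` alone
  -- is the Lyapunov function.
  rcases eq_or_ne β 0 with rfl | hβ0
  · refine ⟨1, 0, one_pos, le_rfl, fun h => absurd rfl h, ?_⟩
    rintro c₀ γ - - ⟨h0, -⟩ x e x' e' t hx - h1 -
    have : γ * δ ^ 2 * x ≤ γ * δ * x := by
      have : δ ^ 2 ≤ δ := by nlinarith
      gcongr
    have : 0 ≤ γ * δ ^ 2 * x := by positivity
    linarith
  have hβp : 0 < β := lt_of_le_of_ne hβ hβ0.symm
  have hδβ := hδβ hβ0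
  -- With `p = q = 0` excess, i.e. `p : q = β : δ`, the contraction `γδp` would exactly cancel the
  -- feedback `γβq`. The extra `δ / 2` in `p` leaves a gain `γβδ²/2` in the `x` coefficient.
  refine ⟨β * (1 + δ / 2), δ, by positivity, hδ.le, fun _ => hδ, ?_⟩
  rintro c₀ γ hc hc2 ⟨h0, h1, -, h2⟩ x e x' e' t hx he hx' he'
  -- Only the summand `(1 + 2/δ) β²` of `κ₂` is needed here.
  have hγ : γ * β ^ 2 * (2 + δ) ≤ c₀ * δ := by
    rw [kappa2] at h2
    have h3 : 0 ≤ γ * ((1 + c₀⁻¹) ^ 2 * γ * β ^ 2) := by positivity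
    have h4 : γ * ((1 + 2 / δ) * β ^ 2) ≤ c₀ := by linarith
    calc γ * β ^ 2 * (2 + δ) = γ * ((1 + 2 / δ) * β ^ 2) * δ := by field_simp; ring
      _ ≤ c₀ * δ := by gcongr
  have hγδ : γ * β * δ ≤ γ * β ^ 2 := by
    rw [pow_two, ← mul_assoc]; gcongr
  have hγδδ : γ * δ ^ 2 ≤ γ * β ^ 2 := by gcongr
  have hc1 : 0 ≤ 1 - c₀ := by linarith
  have hA : (1 - γ * δ) * (β * (1 + δ / 2)) + δ * (γ * β)
      ≤ (1 - γ * δ ^ 2 / 6) * (β * (1 + δ / 2)) := by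
    have : γ * β * δ ^ 2 * (δ / 2) ≤ γ * β * δ ^ 2 * (1 / 2) := by gcongr
    have : 0 ≤ γ * β * δ ^ 2 := by positivity
    nlinarith
  -- The gossip terms in the `e` coefficient fit into the compression gain `c₀δ`, with a share
  -- `c₀δ²/6` to spare; that share later pays for the rate `γδ²/6`.
  have hm : γ * β * (β * (1 + δ / 2)) + γ * β * δ ≤ c₀ * δ * (1 - δ / 6) := by
    have h3 : γ * β * (β * (1 + δ / 2)) + γ * β * δ ≤ γ * β ^ 2 * (2 + δ / 2) := by nlinarith
    have h4 : γ * β ^ 2 * (2 + δ / 2) ≤ γ * β ^ 2 * (2 + δ) * (1 - δ / 6) := by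
      have : 0 ≤ γ * β ^ 2 := by positivity
      nlinarith [mul_nonneg this hδ.le, mul_nonneg (mul_nonneg this hδ.le) (sub_nonneg.2 hδ1)]
    exact h3.trans (h4.trans (mul_le_mul_of_nonneg_right hγ (by linarith)))
  have hB : γ * β * (1 - c₀) * (β * (1 + δ / 2)) + δ * ((1 + γ * β) * (1 - c₀))
      ≤ (1 - γ * δ ^ 2 / 6) * δ := by
    have h3 : (γ * β * (β * (1 + δ / 2)) + γ * β * δ) * (1 - c₀)
        ≤ c₀ * δ * (1 - δ / 6) * 1 := by
      have : 0 ≤ c₀ * δ * (1 - δ / 6) :=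
        mul_nonneg (by positivity) (by linarith)
      exact mul_le_mul hm (by linarith) hc1 this
    have h5 : γ * δ ^ 2 ≤ c₀ * δ := by
      have : 0 ≤ γ * β ^ 2 := by positivity
      nlinarith
    have h6 : γ * δ ^ 2 * δ ≤ c₀ * δ * δ := by gcongr
    nlinarith
  have e1 := mul_le_mul_of_nonneg_left hx' (by positivity : 0 ≤ β * (1 + δ / 2))
  have e2 := mul_le_mul_of_nonneg_left he' hδ.le
  have e3 := mul_le_mul_of_nonneg_right hA hx
  have e4 := mul_le_mul_of_nonneg_right hB he
  nlinarith

set_option maxHeartbeats 1000000 in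
/-- The regret bound from the recursions for the consensus error `x`, the compression error `e`,
the distance `D` to the comparator and the linearized regret `A`. -/
theorem exists_regret_bound (δ β L Rlo Rhi lam : ℝ) (hδ1 : δ ≤ 1) (hβ : 0 ≤ β)
    (hδβ : β ≠ 0 → δ ≤ β) (hL : 0 < L) (hRlo : 0 < Rlo) (hRhi : 0 < Rhi) (hlam : 0 < lam) :
    ∃ K₁ K₂ : ℝ, 0 ≤ K₁ ∧ 0 ≤ K₂ ∧ ∀ (n d T : ℕ) (c s γ μ ε : ℝ) (η x e D A h : ℕ → ℝ),
      0 < n → 1 ≤ d → 0 < T → 0 < c → 0 < s → s ≤ 1 → IsGossipStep δ β (s / 2) γ →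
      lam * s ^ 2 ≤ γ → μ = 1 / √(T : ℝ) → ε = 2 * Rlo / √(T : ℝ) →
      (∀ k, η k = 1 / √((k : ℝ) + c)) → (∀ k, 0 ≤ x k) → (∀ k, 0 ≤ e k) → (∀ k, 0 ≤ D k) →
      (∀ k, 1 ≤ k → x k ≤ 2 * √(n : ℝ) * Rhi) → e 0 ≤ 2 * √(n : ℝ) * Rhi →
      (∀ k, e (k + 1) ≤ (1 - s / 2) * e k + 2 * √(n : ℝ) * Rhi) →
      (∀ k, 1 ≤ k → D k ≤ n * (2 * Rhi) ^ 2) →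
      (∀ k, 1 ≤ k → x (k + 1)
        ≤ (1 - γ * δ) * x k + γ * β * ((1 - s / 2) * e k) + η k * (√(n : ℝ) * (d * L))) →
      (∀ k, 1 ≤ k → e (k + 1)
        ≤ γ * β * x k + (1 + γ * β) * ((1 - s / 2) * e k) + η k * (√(n : ℝ) * (d * L))) →
      (∀ k, 1 ≤ k → D (k + 1) ≤ D k + γ * (β * (1 + 4 * β)) * (x k ^ 2 + ((1 - s / 2) * e k) ^ 2)
        + 2 * η k ^ 2 * (n * (d * L) ^ 2) - 2 * η k * A k) →
      (∀ k, 1 ≤ k → n * h k ≤ A k + √(n : ℝ) * L * x k + n * (2 * L * μ) + n * (L * (ε * Rhi))) →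
      ∑ k ∈ Finset.Icc 1 T, h k ≤ K₁ * ((d : ℝ) ^ 2 * √((T : ℝ) + c))
        + K₂ * ((d : ℝ) ^ 2 / s ^ 2 * √((T : ℝ) + c)) := by
  -- A nonpositive gap admits no gossip step, so any constants serve.
  rcases le_or_gt δ 0 with hδ | hδ
  · refine ⟨0, 0, le_rfl, le_rfl, ?_⟩
    intro n d T c s γ μ ε η x e D A h _ _ _ _ _ _ hg
    exact absurd hg.specGap_pos (not_lt.2 hδ)
  obtain ⟨p, q, hp, hq, hqβ, hpq⟩ := exists_lyapunov_weights hδ hδ1 hβ hδβ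
  -- `C` dominates the `x²` and `e²` costs by `v²`; the additional `1` is for the Young term of the
  -- consensus error. If `β = 0`, `q` may vanish, but then the last summand has numerator zero.
  set C := (β * (1 + 4 * β) / 2 + 1) / p ^ 2 + β * (1 + 4 * β) / 2 / q ^ 2
  have hC : 0 ≤ C := by positivity
  refine ⟨2 * Rhi ^ 2 + 2 * L ^ 2 + L * (2 + 2 * Rlo * Rhi),
    C * (6 / δ ^ 2) * (p + q) ^ 2 * (16 * Rhi ^ 2 + 12 * L ^ 2 / (lam * δ ^ 2)) + 2 * L ^ 2 / lam,
    by positivity, by positivity, ?_⟩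
  intro n d T c s γ μ ε η x e D A h hn hd hT hc hs hs1 hg hlamγ hμ hε hη hx he hD hxM he0 heM hDM
    hxr her hDr hh
  have hγ := hg.1
  have hγ1 := hg.2.1
  have hηp : ∀ k, 0 < η k := fun k => by rw [hη]; positivity
  have hanti : Antitone η := fun i j hij => by
    rw [hη, hη]
    have : (i : ℝ) ≤ j := by exact_mod_cast hij
    gcongr
  have hn0 : (0 : ℝ) < n := by exact_mod_cast hn
  have hd0 : (1 : ℝ) ≤ d := by exact_mod_cast hd
  have hT0 : (0 : ℝ) < T := by exact_mod_cast hT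
  set M := 2 * √(n : ℝ) * Rhi
  have hM : 0 ≤ M := by positivity
  have hM2 : M ^ 2 = 4 * n * Rhi ^ 2 := by
    simp only [M, mul_pow, Real.sq_sqrt hn0.le]; ring
  set B := √(n : ℝ) * (d * L)
  have hB2 : B ^ 2 = n * (d * L) ^ 2 := by
    simp only [B, mul_pow, Real.sq_sqrt hn0.le]
  have hLB : √(n : ℝ) * L ≤ B := by
    refine mul_le_mul_of_nonneg_left ?_ (Real.sqrt_nonneg _)
    nlinarith
  set c₀ := s / 2
  have hc₀ : 0 < c₀ := by positivity
  have hc₀1 : c₀ ≤ 1 / 2 := by simp only [c₀]; linarith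
  have hMc : M ≤ M / c₀ := by
    rw [le_div_iff₀ hc₀]; nlinarith
  -- `M / c₀` is the fixed point of `e ↦ (1 - c₀) e + M`. This bound needs no gradient estimate, so
  -- it covers iteration 0.
  have heB : ∀ k, e k ≤ M / c₀ := by
    intro k
    induction k with
    | zero => exact he0.trans hMc
    | succ k ih =>
      have h1 := mul_le_mul_of_nonneg_left ih (by linarith : 0 ≤ 1 - c₀)
      have h2 : (1 - c₀) * (M / c₀) + M = M / c₀ := by field_simp; ring
      linarith [heM k]
  set v : ℕ → ℝ := fun k => p * x k + q * e k
  have hv : ∀ k, 0 ≤ v k := fun k =>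
    add_nonneg (mul_nonneg hp.le (hx k)) (mul_nonneg hq (he k))
  have hvM : ∀ k, 1 ≤ k → v k ≤ (p + q) * (M / c₀) := fun k hk => by
    have h1 := mul_le_mul_of_nonneg_left ((hxM k hk).trans hMc) hp.le
    have h2 := mul_le_mul_of_nonneg_left (heB k) hq
    simp only [v]; linarith
  set ρ := γ * δ ^ 2 / 6
  have hρ : 0 < ρ := by positivity
  have hρ1 : ρ ≤ 1 := by
    have : δ ^ 2 ≤ 1 := by nlinarith
    simp only [ρ]; nlinarith
  have hvr : ∀ k, 1 ≤ k → v (k + 1) ≤ (1 - ρ) * v k + ((p + q) * B) * η k := fun k hk => by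
    have := hpq c₀ γ hc₀ hc₀1 hg _ _ _ _ _ (hx k) (he k) (hxr k hk) (her k hk)
    calc v (k + 1) ≤ _ := this
      _ = _ := by simp only [v, ρ]; ring
  have hsum := sum_sq_div_le hηp hanti hρ hρ1 hv hvM hvr T
  have hηsum : ∑ k ∈ Finset.Icc 1 T, η k ≤ 2 * √((T : ℝ) + c) := by
    simpa only [hη] using sum_one_div_sqrt_le hc T
  have hηT : ∀ a : ℝ, a / η T = a * √((T : ℝ) + c) := fun a => by rw [hη, div_div_eq_mul_div, div_one]
  have hDsum := sum_sub_div_le (a := D) hηp hanti hDM T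
  set Q := √((T : ℝ) + c)
  have hQ : 0 < Q := Real.sqrt_pos.2 (by positivity)
  have hTQ : √(T : ℝ) ≤ Q := Real.sqrt_le_sqrt (by linarith)
  have hCv : ∀ k, (β * (1 + 4 * β) / 2 + 1) * x k ^ 2 + β * (1 + 4 * β) / 2 * e k ^ 2
      ≤ C * v k ^ 2 := fun k => by
    have hxv : x k ^ 2 ≤ v k ^ 2 / p ^ 2 := by
      rw [← div_pow]
      refine pow_le_pow_left₀ (hx k) ?_ 2
      rw [le_div_iff₀ hp]
      have := mul_nonneg hq (he k)
      simp only [v]; linarith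
    have hev : β * (1 + 4 * β) / 2 * e k ^ 2 ≤ β * (1 + 4 * β) / 2 * (v k ^ 2 / q ^ 2) := by
      rcases eq_or_ne β 0 with h0 | h0
      · simp [h0]
      · refine mul_le_mul_of_nonneg_left ?_ (by positivity)
        rw [← div_pow]
        refine pow_le_pow_left₀ (he k) ?_ 2
        rw [le_div_iff₀ (hqβ h0)]
        have := mul_nonneg hp.le (hx k)
        simp only [v]; linarith
    have h1 := mul_le_mul_of_nonneg_left hxv (by positivity : 0 ≤ β * (1 + 4 * β) / 2 + 1)
    calc _ ≤ _ := add_le_add h1 hev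
      _ = C * v k ^ 2 := by simp only [C]; ring
  have hstep : ∀ k ∈ Finset.Icc 1 T, n * h k ≤ (D k - D (k + 1)) / η k * (1 / 2)
      + C * γ * (v k ^ 2 / η k) + (B ^ 2 + B ^ 2 / γ) * η k
      + n * (L * (2 * μ + ε * Rhi)) := by
    intro k hk
    have hk := (Finset.mem_Icc.1 hk).1
    have hηk := hηp k
    have h1 : A k ≤ (D k - D (k + 1) + γ * (β * (1 + 4 * β)) * (x k ^ 2 + e k ^ 2)
        + 2 * η k ^ 2 * B ^ 2) / η k * (1 / 2) := by
      rw [← mul_div_right_comm, le_div_iff₀ hηk, hB2]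
      have h2 : ((1 - c₀) * e k) ^ 2 ≤ e k ^ 2 := by
        refine pow_le_pow_left₀ (mul_nonneg (by linarith) (he k)) ?_ 2
        nlinarith [he k]
      have h3 : γ * (β * (1 + 4 * β)) * (x k ^ 2 + ((1 - c₀) * e k) ^ 2)
          ≤ γ * (β * (1 + 4 * β)) * (x k ^ 2 + e k ^ 2) := by gcongr
      linarith [hDr k hk]
    -- Young's inequality, weighted by `γ / η` so that the quadratic part joins the gossip cost.
    have h4 : √(n : ℝ) * L * x k ≤ γ * x k ^ 2 / η k + B ^ 2 / γ * η k := by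
      have h5 := mul_le_mul_of_nonneg_right hLB (hx k)
      have h6 : 0 ≤ γ * x k ^ 2 / η k + B ^ 2 / γ * η k - B * x k := by
        have : γ * x k ^ 2 / η k + B ^ 2 / γ * η k - B * x k
            = γ / η k * ((x k - B * η k / (2 * γ)) ^ 2 + 3 / 4 * (B * η k / γ) ^ 2) := by
          field_simp; ring
        rw [this]; positivity
      linarith
    have h7 : γ * ((β * (1 + 4 * β) / 2 + 1) * x k ^ 2 + β * (1 + 4 * β) / 2 * e k ^ 2) / η k
        ≤ γ * (C * v k ^ 2) / η k := by
      have := hCv k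
      gcongr
    have h8 : (D k - D (k + 1) + γ * (β * (1 + 4 * β)) * (x k ^ 2 + e k ^ 2)
        + 2 * η k ^ 2 * B ^ 2) / η k * (1 / 2) + (γ * x k ^ 2 / η k + B ^ 2 / γ * η k)
        = (D k - D (k + 1)) / η k * (1 / 2)
        + γ * ((β * (1 + 4 * β) / 2 + 1) * x k ^ 2 + β * (1 + 4 * β) / 2 * e k ^ 2) / η k
        + (B ^ 2 + B ^ 2 / γ) * η k := by
      field_simp; ring
    have h9 : C * γ * (v k ^ 2 / η k) = γ * (C * v k ^ 2) / η k := by ring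
    linarith [hh k hk]
  have htot := Finset.sum_le_sum hstep
  simp only [Finset.sum_add_distrib, ← Finset.mul_sum, ← Finset.sum_mul, Finset.sum_const,
    Nat.card_Icc, Nat.add_sub_cancel, nsmul_eq_mul] at htot
  rw [hηT] at hsum hDsum
  have i1 : (∑ k ∈ Finset.Icc 1 T, (D k - D (k + 1)) / η k) * (1 / 2)
      ≤ n * (2 * Rhi ^ 2) * Q := by
    have : (n * (2 * Rhi) ^ 2 - D (T + 1)) * Q ≤ n * (2 * Rhi) ^ 2 * Q := by
      have := hD (T + 1)
      gcongr; linarith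
    linarith
  have hinvγ : 1 / γ ≤ 1 / (lam * s ^ 2) := one_div_le_one_div_of_le (by positivity) hlamγ
  have hBρ : B ^ 2 / γ ≤ n * (d ^ 2 / s ^ 2) * (L ^ 2 / lam) := by
    calc B ^ 2 / γ = n * (d * L) ^ 2 * (1 / γ) := by rw [hB2]; ring
      _ ≤ n * (d * L) ^ 2 * (1 / (lam * s ^ 2)) := by gcongr
      _ = _ := by field_simp
  have hds : 1 / s ^ 2 ≤ (d : ℝ) ^ 2 / s ^ 2 := by gcongr; nlinarith
  -- Here `γ = 6ρ / δ²` cancels the `ρ` of the summed recursion. The initial size gives `16 Rhi² /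
  -- s²` from `M / c₀`; the forcing gives the factor `12 = 6 · 2` from `1 / ρ` and from `∑ η ≤ 2Q`.
  have i2 : C * γ * ∑ k ∈ Finset.Icc 1 T, v k ^ 2 / η k
      ≤ n * (C * (6 / δ ^ 2) * (p + q) ^ 2 * (16 * Rhi ^ 2 + 12 * L ^ 2 / (lam * δ ^ 2)))
        * (d ^ 2 / s ^ 2) * Q := by
    have j1 : C * γ * ∑ k ∈ Finset.Icc 1 T, v k ^ 2 / η k
        = C * (6 / δ ^ 2) * (ρ * ∑ k ∈ Finset.Icc 1 T, v k ^ 2 / η k) := by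
      simp only [ρ]; field_simp
    have j2 : ((p + q) * (M / c₀)) ^ 2 ≤ n * (p + q) ^ 2 * (16 * Rhi ^ 2) * (d ^ 2 / s ^ 2) := by
      calc ((p + q) * (M / c₀)) ^ 2 = n * (p + q) ^ 2 * (16 * Rhi ^ 2) * (1 / s ^ 2) := by
            rw [mul_pow, div_pow, hM2]; simp only [c₀]; field_simp; ring
        _ ≤ _ := by gcongr
    have j3 : ((p + q) * B) ^ 2 / ρ * ∑ k ∈ Finset.Icc 1 T, η k
        ≤ n * (p + q) ^ 2 * (12 * L ^ 2 / (lam * δ ^ 2)) * (d ^ 2 / s ^ 2) * Q := by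
      calc ((p + q) * B) ^ 2 / ρ * ∑ k ∈ Finset.Icc 1 T, η k
          ≤ ((p + q) * B) ^ 2 / ρ * (2 * Q) := by gcongr
        _ = (p + q) ^ 2 * (12 / δ ^ 2) * (B ^ 2 / γ) * Q := by
            simp only [ρ]; field_simp; ring
        _ ≤ (p + q) ^ 2 * (12 / δ ^ 2) * (n * (d ^ 2 / s ^ 2) * (L ^ 2 / lam)) * Q := by gcongr
        _ = _ := by field_simp
    rw [j1]
    calc _ ≤ C * (6 / δ ^ 2) * (n * (p + q) ^ 2 * (16 * Rhi ^ 2) * (d ^ 2 / s ^ 2) * Q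
          + n * (p + q) ^ 2 * (12 * L ^ 2 / (lam * δ ^ 2)) * (d ^ 2 / s ^ 2) * Q) := by
          gcongr
          exact hsum.trans (add_le_add (mul_le_mul_of_nonneg_right j2 hQ.le) j3)
      _ = _ := by ring
  have i3 : (B ^ 2 + B ^ 2 / γ) * ∑ k ∈ Finset.Icc 1 T, η k
      ≤ n * (2 * L ^ 2) * d ^ 2 * Q + n * (2 * L ^ 2 / lam) * (d ^ 2 / s ^ 2) * Q := by
    calc _ ≤ (n * (d * L) ^ 2 + n * (d ^ 2 / s ^ 2) * (L ^ 2 / lam)) * (2 * Q) := by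
          rw [← hB2]
          exact mul_le_mul (add_le_add_right hBρ _) hηsum
            (Finset.sum_nonneg fun k _ => (hηp k).le) (by positivity)
      _ = _ := by ring
  -- The biases `μ` and `ε` are of order `1 / √T`, hence sum to order `√T`.
  have i4 : (T : ℝ) * (n * (L * (2 * μ + ε * Rhi))) ≤ n * (L * (2 + 2 * Rlo * Rhi)) * Q := by
    have hsq : (T : ℝ) = √(T : ℝ) * √(T : ℝ) := (Real.mul_self_sqrt hT0.le).symm
    have hsp : 0 < √(T : ℝ) := Real.sqrt_pos.2 hT0
    calc (T : ℝ) * (n * (L * (2 * μ + ε * Rhi)))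
        = n * (L * (2 + 2 * Rlo * Rhi)) * √(T : ℝ) := by
          rw [hμ, hε]; nth_rewrite 1 [hsq]; field_simp
      _ ≤ _ := by gcongr
  have hd2 : (1 : ℝ) ≤ (d : ℝ) ^ 2 := one_le_pow₀ hd0
  have i5 : n * (2 * Rhi ^ 2) * Q + n * (L * (2 + 2 * Rlo * Rhi)) * Q
      ≤ n * (2 * Rhi ^ 2 + L * (2 + 2 * Rlo * Rhi)) * ((d : ℝ) ^ 2 * Q) := by
    have : n * (2 * Rhi ^ 2 + L * (2 + 2 * Rlo * Rhi)) * (1 * Q)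
        ≤ n * (2 * Rhi ^ 2 + L * (2 + 2 * Rlo * Rhi)) * ((d : ℝ) ^ 2 * Q) := by gcongr
    linarith
  refine le_of_mul_le_mul_left ?_ hn0
  refine htot.trans ?_
  linarith

/-! ### The uniform distribution on the sphere -/

section Sphere

open Filter Topology

variable {d : ℕ}

theorem toSphere_univ_ne_zero (hd : 1 ≤ d) :
    (volume : Measure (E d)).toSphere Set.univ ≠ 0 := by
  rw [Measure.toSphere_apply_univ]
  refine mul_ne_zero ?_ (Metric.isOpen_ball.measure_ne_zero _ (by simp))
  simp; omega

theorem isProbabilityMeasure_sphereUniform (hd : 1 ≤ d) :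
    IsProbabilityMeasure (sphereUniform d) := by
  refine ⟨?_⟩
  rw [sphereUniform, Measure.map_apply measurable_subtype_coe .univ, Set.preimage_univ,
    Measure.smul_apply, smul_eq_mul]
  exact ENNReal.inv_mul_cancel (toSphere_univ_ne_zero hd) (measure_ne_top _ _)

theorem ae_norm_eq_one_sphereUniform : ∀ᵐ v ∂sphereUniform d, ‖v‖ = 1 := by
  rw [sphereUniform, ae_map_iff measurable_subtype_coe.aemeasurable
    (measurableSet_eq_fun measurable_norm measurable_const)]
  exact .of_forall fun v => by simp

theorem integral_sphereUniform {Φ : E d → ℝ} (hΦ : Measurable Φ) :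
    ∫ v, Φ v ∂sphereUniform d
      = ((volume : Measure (E d)).toSphere.real Set.univ)⁻¹
        * ∫ v, Φ v.1 ∂(volume : Measure (E d)).toSphere := by
  rw [sphereUniform, integral_map measurable_subtype_coe.aemeasurable
    hΦ.aestronglyMeasurable, integral_smul_measure, ENNReal.toReal_inv, smul_eq_mul]
  rfl

/-- The directions of the points of a centred shell are uniformly distributed. -/
theorem setIntegral_shell_direction (hd : 1 ≤ d) {Φ : E d → ℝ} (hΦ : Measurable Φ) (a b : ℝ) :
    ∫ z in {z : E d | a < ‖z‖ ∧ ‖z‖ < b}, Φ (‖z‖⁻¹ • z)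
      = (∫ v, Φ v ∂sphereUniform d) * volume.real {z : E d | a < ‖z‖ ∧ ‖z‖ < b} := by
  have : Nonempty (Fin d) := ⟨⟨0, hd⟩⟩
  have hs : MeasurableSet {z : E d | a < ‖z‖ ∧ ‖z‖ < b} :=
    (measurableSet_lt measurable_const measurable_norm).inter
      (measurableSet_lt measurable_norm measurable_const)
  have key : ∀ Ψ : E d → ℝ, ∫ z in {z : E d | a < ‖z‖ ∧ ‖z‖ < b}, Ψ (‖z‖⁻¹ • z)
      = (∫ v, Ψ v.1 ∂(volume : Measure (E d)).toSphere)
        * ∫ r, (Set.Ioo a b).indicator (fun _ => (1 : ℝ)) (r : ℝ)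
          ∂Measure.volumeIoiPow (Module.finrank ℝ (E d) - 1) := by
    intro Ψ
    have hE : ∀ f : E d → ℝ, ∫ z, f z
        = ∫ z : ({0}ᶜ : Set (E d)), f z ∂Measure.comap Subtype.val volume := fun f => by
      rw [integral_subtype_comap (measurableSet_singleton (0 : E d)).compl,
        restrict_compl_singleton]
    rw [← integral_prod_mul (fun v : Metric.sphere (0 : E d) 1 => Ψ v.1)
      (fun r : Set.Ioi (0 : ℝ) => (Set.Ioo a b).indicator (fun _ => (1 : ℝ)) (r : ℝ)),
      ← (Measure.measurePreserving_homeomorphUnitSphereProd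
        (volume : Measure (E d))).integral_comp (homeomorphUnitSphereProd (E d)).measurableEmbedding,
      ← integral_indicator hs, hE]
    refine integral_congr_ae (.of_forall fun z => ?_)
    simp only [homeomorphUnitSphereProd_apply_fst_coe, homeomorphUnitSphereProd_apply_snd_coe]
    by_cases h : a < ‖z.1‖ ∧ ‖z.1‖ < b
    · rw [Set.indicator_of_mem (by exact h), Set.indicator_of_mem (by exact h), mul_one]
    · rw [Set.indicator_of_notMem (by exact h), Set.indicator_of_notMem (by exact h), mul_zero]
  -- The constant function expresses the radial factor through the shell volume, so the radial
  -- integral is never computed.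
  have h1 := key fun _ => 1
  rw [integral_const, integral_const, measureReal_restrict_apply_univ, smul_eq_mul, smul_eq_mul,
    mul_one, mul_one] at h1
  have h0 : (volume : Measure (E d)).toSphere.real Set.univ ≠ 0 :=
    ENNReal.toReal_ne_zero.2 ⟨toSphere_univ_ne_zero hd, measure_ne_top _ _⟩
  rw [key, h1, integral_sphereUniform hΦ]
  field_simp

theorem volume_real_shell (hd : 1 ≤ d) {a b : ℝ} (ha : 0 ≤ a) (hab : a < b) :
    volume.real {z : E d | a < ‖z‖ ∧ ‖z‖ < b}
      = (b ^ d - a ^ d) * volume.real (Metric.ball (0 : E d) 1) := by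
  have : Nonempty (Fin d) := ⟨⟨0, hd⟩⟩
  have h : {z : E d | a < ‖z‖ ∧ ‖z‖ < b} = Metric.ball 0 b \ Metric.closedBall 0 a := by
    ext z; simp [and_comm]
  rw [h, measureReal_sdiff (Metric.closedBall_subset_ball hab) measurableSet_closedBall
      measure_ball_lt_top.ne,
    ← Measure.addHaar_real_closedBall_eq_addHaar_real_ball,
    Measure.addHaar_real_closedBall _ _ (ha.trans hab.le), Measure.addHaar_real_closedBall _ _ ha]
  simp; ring

/-! ### Radial cutoffs -/

/-- The radial cutoff that equals `1` up to radius `ρ - h` and vanishes from radius `ρ` on. -/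
noncomputable def cutoff (ρ h : ℝ) (z : E d) : ℝ := max 0 (min 1 (h⁻¹ * (ρ - ‖z‖)))

theorem lipschitzWith_cutoff {ρ h : ℝ} (hh : 0 < h) :
    LipschitzWith (Real.toNNReal h⁻¹) (cutoff (d := d) ρ h) := by
  have h1 : LipschitzWith (Real.toNNReal h⁻¹) fun z : E d => h⁻¹ * (ρ - ‖z‖) := by
    refine LipschitzWith.of_dist_le_mul fun y z => ?_
    rw [Real.dist_eq, ← mul_sub, abs_mul, abs_of_pos (inv_pos.2 hh),
      Real.coe_toNNReal _ (inv_pos.2 hh).le, dist_eq_norm]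
    refine mul_le_mul_of_nonneg_left ?_ (inv_pos.2 hh).le
    rw [sub_sub_sub_cancel_left, abs_sub_comm]
    exact abs_norm_sub_norm_le y z
  exact (h1.const_min 1).const_max 0

theorem cutoff_nonneg (ρ h : ℝ) (z : E d) : 0 ≤ cutoff ρ h z := le_max_left _ _

theorem cutoff_le_one (ρ h : ℝ) (z : E d) : cutoff ρ h z ≤ 1 :=
  max_le zero_le_one (min_le_left _ _)

theorem cutoff_eq_zero {ρ h : ℝ} (hh : 0 < h) {z : E d} (hz : ρ ≤ ‖z‖) : cutoff ρ h z = 0 :=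
  max_eq_left (min_le_of_right_le (mul_nonpos_of_nonneg_of_nonpos (inv_pos.2 hh).le
    (sub_nonpos.2 hz)))

theorem cutoff_eq_one {ρ h : ℝ} (hh : 0 < h) {z : E d} (hz : ‖z‖ ≤ ρ - h) :
    cutoff ρ h z = 1 := by
  have : 1 ≤ h⁻¹ * (ρ - ‖z‖) := by
    rw [← inv_mul_cancel₀ hh.ne']
    exact mul_le_mul_of_nonneg_left (by linarith) (inv_pos.2 hh).le
  rw [cutoff, min_eq_left this, max_eq_right zero_le_one]

theorem hasCompactSupport_cutoff {ρ h : ℝ} (hh : 0 < h) :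
    HasCompactSupport (cutoff (d := d) ρ h) :=
  HasCompactSupport.intro (isCompact_closedBall 0 ρ) fun z hz =>
    cutoff_eq_zero hh (by simpa using (not_le.1 (by simpa using hz)).le)

theorem lineDeriv_norm {z : E d} (hz : z ≠ 0) (w : E d) :
    HasDerivAt (fun t : ℝ => ‖z + t • w‖) (inner ℝ (‖z‖⁻¹ • z) w) 0 := by
  have h1 : HasDerivAt (fun t : ℝ => z + t • w) w 0 := by
    simpa using ((hasDerivAt_id (0 : ℝ)).smul_const w).const_add z
  have h2 := h1.norm_sq
  have hz' : ‖z‖ ≠ 0 := norm_ne_zero_iff.2 hz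
  have h3 := h2.sqrt (by simpa using hz')
  simp only [Real.sqrt_sq (norm_nonneg _), zero_smul, add_zero] at h3
  convert! h3 using 1
  rw [inner_smul_left]
  simp
  field_simp

theorem lineDeriv_cutoff_of_mem_shell {ρ h : ℝ} (hh : 0 < h) (hρ : h < ρ) {z : E d}
    (h1 : ρ - h < ‖z‖) (h2 : ‖z‖ < ρ) (w : E d) :
    lineDeriv ℝ (cutoff ρ h) z (-w) = h⁻¹ * inner ℝ (‖z‖⁻¹ • z) w := by
  have hz : z ≠ 0 := norm_pos_iff.1 (by linarith)
  have hd : HasDerivAt (fun t : ℝ => h⁻¹ * (ρ - ‖z + t • (-w)‖))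
      (h⁻¹ * (- inner ℝ (‖z‖⁻¹ • z) (-w))) 0 :=
    ((lineDeriv_norm hz (-w)).const_sub ρ).const_mul h⁻¹
  rw [inner_neg_right, neg_neg] at hd
  refine (hd.congr_of_eventuallyEq ?_).deriv
  have hc : Continuous fun t : ℝ => ‖z + t • (-w)‖ := by fun_prop
  have e1 : ∀ᶠ t in 𝓝 (0 : ℝ), ρ - h < ‖z + t • (-w)‖ :=
    hc.continuousAt.eventually_const_lt (by simpa using h1)
  have e2 : ∀ᶠ t in 𝓝 (0 : ℝ), ‖z + t • (-w)‖ < ρ :=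
    hc.continuousAt.eventually_lt_const (by simpa using h2)
  filter_upwards [e1, e2] with t ht1 ht2
  have : h⁻¹ * (ρ - ‖z + t • (-w)‖) ≤ 1 := by
    rw [inv_mul_le_iff₀ hh]; linarith
  rw [cutoff, min_eq_right this, max_eq_right]
  exact mul_nonneg (inv_pos.2 hh).le (by linarith)

theorem lineDeriv_cutoff_of_notMem_shell {ρ h : ℝ} (hh : 0 < h) {z : E d}
    (hz : ‖z‖ < ρ - h ∨ ρ < ‖z‖) (w : E d) : lineDeriv ℝ (cutoff ρ h) z w = 0 := by
  have hc : Continuous fun t : ℝ => ‖z + t • w‖ := by fun_prop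
  rcases hz with hz | hz
  · refine ((hasDerivAt_const (0 : ℝ) (1 : ℝ)).congr_of_eventuallyEq ?_).deriv
    filter_upwards [hc.continuousAt.eventually_lt_const (by simpa using hz)] with t ht
    exact cutoff_eq_one hh ht.le
  · refine ((hasDerivAt_const (0 : ℝ) (0 : ℝ)).congr_of_eventuallyEq ?_).deriv
    filter_upwards [hc.continuousAt.eventually_const_lt (by simpa using hz)] with t ht
    exact cutoff_eq_zero hh ht.le

/-- The cutoff is locally constant off the shell and has gradient `-h⁻¹ z / ‖z‖` inside it; the two
bounding spheres are null sets. -/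
theorem integral_lineDeriv_cutoff (hd : 1 ≤ d) {ρ h : ℝ} (hh : 0 < h) (hρ : h < ρ)
    (w : E d) (g : E d → ℝ) :
    ∫ z, lineDeriv ℝ (cutoff ρ h) z (-w) * g z
      = h⁻¹ * ∫ z in {z : E d | ρ - h < ‖z‖ ∧ ‖z‖ < ρ}, inner ℝ (‖z‖⁻¹ • z) w * g z := by
  have : Nonempty (Fin d) := ⟨⟨0, hd⟩⟩
  have hs : MeasurableSet {z : E d | ρ - h < ‖z‖ ∧ ‖z‖ < ρ} :=
    (measurableSet_lt measurable_const measurable_norm).inter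
      (measurableSet_lt measurable_norm measurable_const)
  rw [← integral_const_mul, ← integral_indicator hs]
  have hsph : ∀ r : ℝ, ∀ᵐ z : E d, ‖z‖ ≠ r := fun r => by
    have := Measure.addHaar_sphere (volume : Measure (E d)) 0 r
    rw [measure_eq_zero_iff_ae_notMem] at this
    simpa using this
  refine integral_congr_ae ?_
  filter_upwards [hsph (ρ - h), hsph ρ] with z h1 h2
  by_cases hz : ρ - h < ‖z‖ ∧ ‖z‖ < ρ
  · rw [Set.indicator_of_mem (by exact hz), lineDeriv_cutoff_of_mem_shell hh hρ hz.1 hz.2,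
      mul_assoc]
  · rw [Set.indicator_of_notMem (by exact hz), lineDeriv_cutoff_of_notMem_shell hh, zero_mul]
    rcases lt_or_gt_of_ne h1 with h | h
    · exact .inl h
    · exact .inr (lt_of_le_of_ne (not_lt.1 fun h' => hz ⟨h, h'⟩) h2.symm)

end Sphere

/-! ### The sphere estimator as an approximate subgradient. -/

section SphereGradient

open Filter Topology

variable {d : ℕ}

/-- Averaging the increments of a function that is convex on the segments swept by a ball:
the increment along `w` dominates the directional derivative along `w`. -/
theorem integral_lineDeriv_cutoff_mul_le {ρ h : ℝ} (hh : 0 < h) {g : E d → ℝ}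
    (hg : Continuous g) {w : E d}
    (hconv : ∀ z : E d, ‖z‖ ≤ ρ → ∀ t : ℝ, 0 ≤ t → t ≤ 1 →
      g (z + t • w) ≤ (1 - t) * g z + t * g (z + w)) :
    ∫ z, lineDeriv ℝ (cutoff ρ h) z (-w) * g z
      ≤ ∫ z, cutoff ρ h z * (g (z + w) - g z) := by
  have hcc : Continuous (cutoff (d := d) ρ h) := (lipschitzWith_cutoff hh).continuous
  have hint : ∀ f : E d → ℝ, Continuous f → Integrable fun z => cutoff ρ h z * f z :=
    fun f hf => (hcc.mul hf).integrable_of_hasCompactSupport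
      (hasCompactSupport_cutoff hh).mul_right
  -- A Lipschitz, compactly supported cutoff is regular enough to pass to the limit in its
  -- difference quotients. For fixed `t`, translation moves the increment onto `g`, where convexity
  -- applies pointwise.
  refine le_of_tendsto ((lipschitzWith_cutoff hh).integral_inv_smul_sub_mul_tendsto_integral_lineDeriv_mul'
    (μ := volume) (hasCompactSupport_cutoff (ρ := ρ) hh) hg (-w)) ?_
  filter_upwards [Ioo_mem_nhdsGT (zero_lt_one' ℝ)] with t ht
  have h1 : ∫ z, cutoff ρ h (z + t • -w) * g z = ∫ z, cutoff ρ h z * g (z + t • w) := by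
    rw [← integral_add_right_eq_self _ (t • w)]
    refine integral_congr_ae (.of_forall fun z => ?_)
    simp only
    congr 2
    module
  have hi1 : Integrable fun z => cutoff ρ h z * g (z + t • w) := hint (fun z => g (z + t • w)) (by fun_prop)
  have hi1' : Integrable fun z => cutoff ρ h (z + t • -w) * g z := by
    have := hi1.comp_add_right (t • -w)
    refine this.congr (.of_forall fun z => ?_)
    simp only
    congr 2
    module
  have hi2 := hint g hg
  have h2 : ∫ z, t⁻¹ • (cutoff ρ h (z + t • -w) - cutoff ρ h z) * g z
      = ∫ z, cutoff ρ h z * (t⁻¹ * (g (z + t • w) - g z)) := by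
    calc _ = t⁻¹ * ((∫ z, cutoff ρ h (z + t • -w) * g z) - ∫ z, cutoff ρ h z * g z) := by
          rw [← integral_sub hi1' hi2, ← integral_const_mul]
          refine integral_congr_ae (.of_forall fun z => ?_)
          simp only [smul_eq_mul]; ring
      _ = _ := by
          rw [h1, ← integral_sub hi1 hi2, ← integral_const_mul]
          refine integral_congr_ae (.of_forall fun z => ?_)
          simp only; ring
  rw [h2]
  refine integral_mono (hint (fun z => t⁻¹ * (g (z + t • w) - g z)) (by fun_prop))
    (hint (fun z => g (z + w) - g z) (by fun_prop)) fun z => ?_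
  rcases le_or_gt ‖z‖ ρ with hz | hz
  · refine mul_le_mul_of_nonneg_left ?_ (cutoff_nonneg _ _ _)
    rw [inv_mul_le_iff₀ ht.1]
    linarith [hconv z hz t ht.1.le ht.2.le]
  · simp [cutoff_eq_zero hh hz.le]

/-- Replacing `g z` by its value at the radial projection of `z` to radius `ρ` costs at most `L h`;
what remains depends on the direction only. -/
theorem le_setIntegral_shell (hd : 1 ≤ d) {ρ h L : ℝ} (hh : 0 < h) (hρ : h < ρ) {g : E d → ℝ}
    (hg : Continuous g) (hL : ∀ y z, |g y - g z| ≤ L * ‖y - z‖) (w : E d) :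
    (∫ v, g (ρ • v) * inner ℝ v w ∂sphereUniform d - L * h * ‖w‖)
        * volume.real {z : E d | ρ - h < ‖z‖ ∧ ‖z‖ < ρ}
      ≤ ∫ z in {z : E d | ρ - h < ‖z‖ ∧ ‖z‖ < ρ}, inner ℝ (‖z‖⁻¹ • z) w * g z := by
  set s := {z : E d | ρ - h < ‖z‖ ∧ ‖z‖ < ρ}
  have hs : MeasurableSet s := (measurableSet_lt measurable_const measurable_norm).inter
      (measurableSet_lt measurable_norm measurable_const)
  have hsub : s ⊆ Metric.closedBall 0 ρ := fun z hz => by simpa using hz.2.le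
  have hfin : volume s ≠ ⊤ :=
    ((measure_mono hsub).trans_lt measure_closedBall_lt_top).ne
  obtain ⟨B, hB⟩ := (isCompact_closedBall (0 : E d) ρ).exists_bound_of_continuousOn hg.continuousOn
  have hnorm : ∀ z ∈ s, ‖‖z‖⁻¹ • z‖ = 1 := fun z hz => by
    have : ‖z‖ ≠ 0 := (by linarith [hz.1] : 0 < ‖z‖).ne'
    simp [norm_smul, this]
  have hinner : ∀ z ∈ s, |inner ℝ (‖z‖⁻¹ • z) w| ≤ ‖w‖ := fun z hz => by
    have := abs_real_inner_le_norm (‖z‖⁻¹ • z) w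
    rwa [hnorm z hz, one_mul] at this
  have hmΦ : Measurable fun v : E d => g (ρ • v) * inner ℝ v w := by fun_prop
  rw [sub_mul, ← setIntegral_shell_direction hd hmΦ]
  have hmes : Measurable fun z : E d => ‖z‖⁻¹ • z := by fun_prop
  have hi2 : IntegrableOn (fun z => inner ℝ (‖z‖⁻¹ • z) w * g z) s := by
    refine Measure.integrableOn_of_bounded (M := ‖w‖ * B) hfin ?_ ?_
    · exact ((hmes.inner measurable_const).mul hg.measurable).aestronglyMeasurable
    · filter_upwards [ae_restrict_mem hs] with z hz
      rw [norm_mul]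
      exact mul_le_mul (hinner z hz) (hB z (hsub hz)) (norm_nonneg _) (norm_nonneg _)
  have hi1 : IntegrableOn (fun z => g (ρ • ‖z‖⁻¹ • z) * inner ℝ (‖z‖⁻¹ • z) w) s := by
    refine Measure.integrableOn_of_bounded (M := B * ‖w‖) hfin ?_ ?_
    · exact (hmΦ.comp hmes).aestronglyMeasurable
    · filter_upwards [ae_restrict_mem hs] with z hz
      rw [norm_mul]
      refine mul_le_mul (hB _ ?_) (hinner z hz) (norm_nonneg _) ?_
      · rw [mem_closedBall_zero_iff, norm_smul, hnorm z hz, mul_one,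
          Real.norm_of_nonneg (by linarith)]
      · exact (norm_nonneg _).trans (hB 0 (by simp; linarith))
  have hi3 : IntegrableOn (fun _ : E d => L * h * ‖w‖) s := integrableOn_const hfin
  have hc : L * h * ‖w‖ * volume.real s = ∫ _ in s, L * h * ‖w‖ := by
    rw [setIntegral_const, smul_eq_mul, mul_comm]
  rw [hc, ← integral_sub hi1 hi3]
  refine setIntegral_mono_on (hi1.sub hi3) hi2 hs fun z hz => ?_
  have hz0 : 0 < ‖z‖ := by linarith [hz.1]
  have h1 : |g (ρ • ‖z‖⁻¹ • z) - g z| ≤ L * h := by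
    have hL0 : 0 ≤ L := by
      by_contra! hneg
      have h5 := (abs_nonneg _).trans (hL z 0)
      rw [sub_zero] at h5
      nlinarith
    refine (hL _ _).trans (mul_le_mul_of_nonneg_left ?_ hL0)
    have : ρ • ‖z‖⁻¹ • z - z = (ρ - ‖z‖) • ‖z‖⁻¹ • z := by
      rw [sub_smul, smul_inv_smul₀ hz0.ne']
    rw [this, norm_smul, hnorm z hz, mul_one, Real.norm_of_nonneg (by linarith [hz.2])]
    linarith [hz.1]
  have h2 : |(g (ρ • ‖z‖⁻¹ • z) - g z) * inner ℝ (‖z‖⁻¹ • z) w| ≤ L * h * ‖w‖ := by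
    rw [abs_mul]
    exact mul_le_mul h1 (hinner z hz) (abs_nonneg _) ((abs_nonneg _).trans h1)
  have h3 := (abs_le.1 h2).2
  linarith

/-- The two-point sphere estimator of a convex Lipschitz function is, in expectation, an
approximate subgradient. -/
theorem sphere_estimator_subgradient (hd : 1 ≤ d) {Om : Set (E d)} {F : E d → ℝ} {L ρ : ℝ}
    (hL : 0 ≤ L) (hρ : 0 < ρ) (hconv : ConvexOn ℝ Om F)
    (hlip : ∀ x ∈ Om, ∀ y ∈ Om, |F x - F y| ≤ L * ‖x - y‖) {x y : E d}
    (hx : ∀ z : E d, ‖z‖ ≤ ρ → x + z ∈ Om) (hy : ∀ z : E d, ‖z‖ ≤ ρ → y + z ∈ Om) :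
    d / ρ * ∫ v, (F (x + ρ • v) - F x) * inner ℝ v (y - x) ∂sphereUniform d
      ≤ F y - F x + 2 * L * ρ := by
  have : Nonempty (Fin d) := ⟨⟨0, hd⟩⟩
  have hx0 : x ∈ Om := by simpa using hx 0 (by simpa using hρ.le)
  have hy0 : y ∈ Om := by simpa using hy 0 (by simpa using hρ.le)
  -- The integrals run over the whole space while `F` is controlled only on `Om`. Any Lipschitz
  -- extension serves, since the final values involve only the balls around `x` and `y`.
  obtain ⟨f, hf, hfF⟩ := LipschitzOnWith.extend_real (f := F) (s := Om) (K := ⟨L, hL⟩)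
    (LipschitzOnWith.of_dist_le_mul fun a ha b hb => by
      rw [Real.dist_eq, dist_eq_norm]; exact hlip a ha b hb)
  set w := y - x
  set g : E d → ℝ := fun z => f (x + z) - F x
  have hg : Continuous g := (hf.continuous.comp (continuous_const.add continuous_id)).sub
    continuous_const
  have hgL : ∀ a b, |g a - g b| ≤ L * ‖a - b‖ := fun a b => by
    have := hf.dist_le_mul (x + a) (x + b)
    rw [Real.dist_eq, dist_eq_norm, add_sub_add_left_eq_sub] at this
    simp only [g, sub_sub_sub_cancel_right]
    exact this
  have hxw : ∀ z, x + (z + w) = y + z := fun z => by simp only [w]; abel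
  have hgF : ∀ z : E d, ‖z‖ ≤ ρ → g z = F (x + z) - F x := fun z hz => by
    simp only [g]; rw [← hfF (hx z hz)]
  have hgw : ∀ z : E d, ‖z‖ ≤ ρ → g (z + w) = F (y + z) - F x := fun z hz => by
    simp only [g]; rw [hxw, ← hfF (hy z hz)]
  have hgconv : ∀ z : E d, ‖z‖ ≤ ρ → ∀ t : ℝ, 0 ≤ t → t ≤ 1 →
      g (z + t • w) ≤ (1 - t) * g z + t * g (z + w) := by
    intro z hz t ht0 ht1
    have h1 := hconv.2 (hx z hz) (hy z hz) (sub_nonneg.2 ht1) ht0 (by ring)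
    have h2 := hconv.1 (hx z hz) (hy z hz) (sub_nonneg.2 ht1) ht0 (by ring)
    have h3 : (1 - t) • (x + z) + t • (y + z) = x + (z + t • w) := by
      simp only [w]; module
    rw [h3] at h1 h2
    rw [hgF z hz, hgw z hz]
    simp only [g]
    rw [← hfF h2]
    simp only [smul_eq_mul] at h1
    linarith
  set A := ∫ v, g (ρ • v) * inner ℝ v w ∂sphereUniform d
  have hA : ∫ v, (F (x + ρ • v) - F x) * inner ℝ v (y - x) ∂sphereUniform d = A := by
    refine integral_congr_ae ?_
    filter_upwards [ae_norm_eq_one_sphereUniform] with v hv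
    rw [hgF]
    rw [norm_smul, hv, mul_one, Real.norm_of_nonneg hρ.le]
  rw [hA]
  -- Bounds `F (y + z) - F (x + z)` over the ball: shifting each endpoint by `z` costs `Lρ`.
  set Kc := F y - F x + 2 * L * ρ
  set V := volume.real (Metric.ball (0 : E d) 1)
  have hV : 0 < V := ENNReal.toReal_pos (Metric.isOpen_ball.measure_ne_zero _ (by simp))
    measure_ball_lt_top.ne
  set m : ℝ → ℝ := fun h => ∫ z : E d, cutoff ρ h z
  have hmint : ∀ h : ℝ, 0 < h → Integrable (cutoff (d := d) ρ h) := fun h hh =>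
    (lipschitzWith_cutoff hh).continuous.integrable_of_hasCompactSupport
      (hasCompactSupport_cutoff hh)
  have hmain : ∀ h ∈ Set.Ioo 0 ρ, h⁻¹ * ((A - L * h * ‖w‖) * ((ρ ^ d - (ρ - h) ^ d) * V))
      ≤ Kc * m h := by
    rintro h ⟨hh, hhρ⟩
    have h1 := integral_lineDeriv_cutoff_mul_le hh hg hgconv
    rw [integral_lineDeriv_cutoff hd hh hhρ] at h1
    have h2 := le_setIntegral_shell hd hh hhρ hg hgL w
    rw [volume_real_shell hd (by linarith) (by linarith)] at h2
    have h3 : ∫ z, cutoff ρ h z * (g (z + w) - g z) ≤ Kc * m h := by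
      simp only [m]
      rw [← integral_const_mul]
      refine integral_mono ?_ ((hmint h hh).const_mul _) fun z => ?_
      · exact ((lipschitzWith_cutoff hh).continuous.mul
          (by fun_prop : Continuous fun z => g (z + w) - g z)).integrable_of_hasCompactSupport
          (hasCompactSupport_cutoff hh).mul_right
      · rcases le_or_gt ‖z‖ ρ with hz | hz
        · simp only
          rw [mul_comm]
          refine mul_le_mul_of_nonneg_right ?_ (cutoff_nonneg _ _ _)
          rw [hgF z hz, hgw z hz]
          have e1 := (abs_le.1 (hlip _ (hy z hz) _ hy0)).2
          have e2 := (abs_le.1 (hlip _ (hx z hz) _ hx0)).1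
          have e3 : L * ‖z‖ ≤ L * ρ := mul_le_mul_of_nonneg_left hz hL
          rw [add_sub_cancel_left] at e1 e2
          simp only [Kc]
          linarith
        · simp [cutoff_eq_zero hh hz.le]
    exact (mul_le_mul_of_nonneg_left h2 (inv_pos.2 hh).le).trans (h1.trans h3)
  have hlo : ∀ h ∈ Set.Ioo 0 ρ, (ρ - h) ^ d * V ≤ m h := by
    rintro h ⟨hh, hhρ⟩
    have e := Measure.addHaar_real_closedBall (volume : Measure (E d)) 0 (sub_nonneg.2 hhρ.le)
    rw [finrank_euclideanSpace_fin] at e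
    rw [← e, ← integral_indicator_one measurableSet_closedBall]
    refine integral_mono ((integrable_indicator_iff measurableSet_closedBall).2
      (integrableOn_const measure_closedBall_lt_top.ne)) (hmint h hh) fun z => ?_
    by_cases hz : z ∈ Metric.closedBall (0 : E d) (ρ - h)
    · rw [Set.indicator_of_mem hz, cutoff_eq_one hh (by simpa using hz)]; rfl
    · rw [Set.indicator_of_notMem hz]; exact cutoff_nonneg _ _ _
  have hhi : ∀ h ∈ Set.Ioo 0 ρ, m h ≤ ρ ^ d * V := by
    rintro h ⟨hh, hhρ⟩
    have e := Measure.addHaar_real_closedBall (volume : Measure (E d)) 0 hρ.le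
    rw [finrank_euclideanSpace_fin] at e
    rw [← e, ← integral_indicator_one measurableSet_closedBall]
    refine integral_mono (hmint h hh) ((integrable_indicator_iff measurableSet_closedBall).2
      (integrableOn_const measure_closedBall_lt_top.ne)) fun z => ?_
    by_cases hz : z ∈ Metric.closedBall (0 : E d) ρ
    · rw [Set.indicator_of_mem hz]; exact cutoff_le_one _ _ _
    · rw [Set.indicator_of_notMem hz, cutoff_eq_zero hh]
      exact (not_le.1 (by simpa using hz)).le
  have hmem : Set.Ioo 0 ρ ∈ 𝓝[>] (0 : ℝ) := Ioo_mem_nhdsGT hρ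
  have hmlim : Tendsto m (𝓝[>] 0) (𝓝 (ρ ^ d * V)) := by
    have hl : Tendsto (fun h => (ρ - h) ^ d * V) (𝓝[>] 0) (𝓝 (ρ ^ d * V)) := by
      have : Continuous fun h : ℝ => (ρ - h) ^ d * V := by fun_prop
      have := this.tendsto 0
      rw [sub_zero] at this
      exact this.mono_left nhdsWithin_le_nhds
    refine tendsto_of_tendsto_of_tendsto_of_le_of_le' hl tendsto_const_nhds ?_ ?_
    · filter_upwards [hmem] with h hh using hlo h hh
    · filter_upwards [hmem] with h hh using hhi h hh
  have hslope : Tendsto (fun h : ℝ => h⁻¹ * (ρ ^ d - (ρ - h) ^ d)) (𝓝[>] 0)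
      (𝓝 (d * ρ ^ (d - 1))) := by
    have hder : HasDerivAt (fun h : ℝ => -(ρ - h) ^ d) (d * ρ ^ (d - 1)) 0 := by
      refine (((hasDerivAt_id' (0 : ℝ)).const_sub ρ).fun_pow d).fun_neg.congr_deriv ?_
      simp
    have := hder.tendsto_slope_zero_right
    refine this.congr fun h => ?_
    simp only [zero_add, sub_zero, smul_eq_mul]
    ring
  have hfac : Tendsto (fun h : ℝ => A - L * h * ‖w‖) (𝓝[>] 0) (𝓝 A) := by
    have : Continuous fun h : ℝ => A - L * h * ‖w‖ := by fun_prop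
    have := this.tendsto 0
    simp only [mul_zero, zero_mul, sub_zero] at this
    exact this.mono_left nhdsWithin_le_nhds
  -- As `h → 0` this becomes `A · d ρ^(d-1) V ≤ Kc · ρ^d V`: surface measure on the left, ball
  -- volume on the right, and their quotient is the factor `d / ρ`.
  have hlim := le_of_tendsto_of_tendsto ((hfac.mul hslope).mul_const V) (hmlim.const_mul Kc) (by
    filter_upwards [hmem] with h hh
    refine le_trans (le_of_eq ?_) (hmain h hh)
    ring)
  have hpow : ρ ^ d = ρ * ρ ^ (d - 1) := by
    rw [← pow_succ', Nat.sub_add_cancel hd]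
  rw [hpow] at hlim
  have hp : 0 < ρ ^ (d - 1) * V := by positivity
  have h5 : (d * A) * (ρ ^ (d - 1) * V) ≤ (Kc * ρ) * (ρ ^ (d - 1) * V) := by linarith
  have h6 := le_of_mul_le_mul_right h5 hp
  rw [div_mul_eq_mul_div, div_le_iff₀ hρ]
  exact h6

end SphereGradient

/-! ### Second moments -/

section SecondMoment

variable {S : Type*} [MeasurableSpace S] {Pr : Measure S} {V V₁ V₂ : Type*}
  [NormedAddCommGroup V] [NormedAddCommGroup V₁] [NormedAddCommGroup V₂]

theorem lpNorm_two_sq {f : S → V} (hf : MemLp f 2 Pr) :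
    lpNorm f 2 Pr ^ 2 = ∫ s, ‖f s‖ ^ 2 ∂Pr := by
  rw [lpNorm_eq_integral_norm_rpow_toReal (by norm_num) (by norm_num) hf.1]
  have h : 0 ≤ ∫ s, ‖f s‖ ^ 2 ∂Pr := integral_nonneg fun _ => sq_nonneg _
  simp only [ENNReal.toReal_ofNat, Real.rpow_ofNat]
  rw [← Real.rpow_natCast, ← Real.rpow_mul h]
  norm_num

/-- Nonnegativity of the variance of `‖f‖`. -/
theorem integral_norm_le_lpNorm_two [IsProbabilityMeasure Pr] {f : S → V} (hf : MemLp f 2 Pr) :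
    ∫ s, ‖f s‖ ∂Pr ≤ lpNorm f 2 Pr := by
  refine le_of_sq_le_sq ?_ lpNorm_nonneg
  rw [lpNorm_two_sq hf]
  have h1 : Integrable (fun s => ‖f s‖) Pr := (hf.integrable (by norm_num)).norm
  have h2 : Integrable (fun s => ‖f s‖ ^ 2) Pr := hf.integrable_norm_pow (by norm_num)
  set m := ∫ s, ‖f s‖ ∂Pr
  have h3 : 0 ≤ ∫ s, (‖f s‖ - m) ^ 2 ∂Pr := integral_nonneg fun _ => sq_nonneg _
  have h4 : ∫ s, (‖f s‖ - m) ^ 2 ∂Pr = ∫ s, ‖f s‖ ^ 2 ∂Pr - m ^ 2 := by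
    have : ∀ s, (‖f s‖ - m) ^ 2 = ‖f s‖ ^ 2 - (2 * m * ‖f s‖ - m ^ 2) := fun s => by ring
    simp only [this]
    have h5 : Integrable (fun s => 2 * m * ‖f s‖ - m ^ 2) Pr :=
      (h1.const_mul _).sub (integrable_const _)
    rw [integral_sub h2 h5, integral_sub (h1.const_mul _) (integrable_const _), integral_const_mul, integral_const]
    simp only [probReal_univ, one_smul, m]
    ring
  linarith

/-- A pointwise affine bound on norms passes to the `L²` norms. -/
theorem lpNorm_two_le_of_ae_norm_le [IsProbabilityMeasure Pr] {f : S → V} {g : S → V₁}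
    {h : S → V₂} {a b c : ℝ} (ha : 0 ≤ a) (hb : 0 ≤ b) (hc : 0 ≤ c) (hf : MemLp f 2 Pr)
    (hg : MemLp g 2 Pr) (hh : MemLp h 2 Pr)
    (hle : ∀ᵐ s ∂Pr, ‖f s‖ ≤ a * ‖g s‖ + b * ‖h s‖ + c) :
    lpNorm f 2 Pr ≤ a * lpNorm g 2 Pr + b * lpNorm h 2 Pr + c := by
  refine le_of_sq_le_sq ?_ (by
    have := lpNorm_nonneg (f := g) (p := 2) (μ := Pr)
    have := lpNorm_nonneg (f := h) (p := 2) (μ := Pr)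
    positivity)
  have hg1 : Integrable (fun s => ‖g s‖) Pr := (hg.integrable (by norm_num)).norm
  have hh1 : Integrable (fun s => ‖h s‖) Pr := (hh.integrable (by norm_num)).norm
  have hg2 : Integrable (fun s => ‖g s‖ ^ 2) Pr := hg.integrable_norm_pow (by norm_num)
  have hh2 : Integrable (fun s => ‖h s‖ ^ 2) Pr := hh.integrable_norm_pow (by norm_num)
  have hf2 : Integrable (fun s => ‖f s‖ ^ 2) Pr := hf.integrable_norm_pow (by norm_num)
  have hgh : Integrable (fun s => ‖g s‖ * ‖h s‖) Pr := hg.norm.integrable_mul hh.norm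
  have hgn := integral_norm_le_lpNorm_two hg
  have hhn := integral_norm_le_lpNorm_two hh
  set x := lpNorm g 2 Pr
  set y := lpNorm h 2 Pr
  have hx : 0 ≤ x := lpNorm_nonneg
  have hy : 0 ≤ y := lpNorm_nonneg
  -- Cauchy–Schwarz for the mixed term; with the first-moment bounds, each term of the expanded
  -- square is dominated.
  have hcs : ∫ s, ‖g s‖ * ‖h s‖ ∂Pr ≤ x * y := by
    have h1 := integral_mul_norm_le_Lp_mul_Lq (μ := Pr) (f := fun s => ‖g s‖) (g := fun s => ‖h s‖)
      (p := 2) (q := 2) ⟨by norm_num, by norm_num, by norm_num⟩ (by simpa using hg.norm)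
      (by simpa using hh.norm)
    simp only [norm_norm, Real.rpow_ofNat] at h1
    rw [← lpNorm_two_sq hg, ← lpNorm_two_sq hh] at h1
    refine h1.trans_eq ?_
    rw [← Real.sqrt_eq_rpow, ← Real.sqrt_eq_rpow, Real.sqrt_sq hx, Real.sqrt_sq hy]
  have i1 : Integrable (fun s => a ^ 2 * ‖g s‖ ^ 2 + b ^ 2 * ‖h s‖ ^ 2) Pr :=
    (hg2.const_mul _).add (hh2.const_mul _)
  have i2 : Integrable (fun s => a ^ 2 * ‖g s‖ ^ 2 + b ^ 2 * ‖h s‖ ^ 2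
      + 2 * a * b * (‖g s‖ * ‖h s‖)) Pr := i1.add (hgh.const_mul _)
  have i3 : Integrable (fun s => a ^ 2 * ‖g s‖ ^ 2 + b ^ 2 * ‖h s‖ ^ 2
      + 2 * a * b * (‖g s‖ * ‖h s‖) + 2 * a * c * ‖g s‖) Pr := i2.add (hg1.const_mul _)
  have i4 : Integrable (fun s => a ^ 2 * ‖g s‖ ^ 2 + b ^ 2 * ‖h s‖ ^ 2
      + 2 * a * b * (‖g s‖ * ‖h s‖) + 2 * a * c * ‖g s‖ + 2 * b * c * ‖h s‖) Pr :=
    i3.add (hh1.const_mul _)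
  have hrhs : Integrable (fun s => a ^ 2 * ‖g s‖ ^ 2 + b ^ 2 * ‖h s‖ ^ 2
      + 2 * a * b * (‖g s‖ * ‖h s‖) + 2 * a * c * ‖g s‖ + 2 * b * c * ‖h s‖ + c ^ 2) Pr :=
    i4.add (integrable_const _)
  rw [lpNorm_two_sq hf]
  calc ∫ s, ‖f s‖ ^ 2 ∂Pr
      ≤ ∫ s, (a ^ 2 * ‖g s‖ ^ 2 + b ^ 2 * ‖h s‖ ^ 2 + 2 * a * b * (‖g s‖ * ‖h s‖)
        + 2 * a * c * ‖g s‖ + 2 * b * c * ‖h s‖ + c ^ 2) ∂Pr := by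
        refine integral_mono_ae hf2 hrhs ?_
        filter_upwards [hle] with s hs
        exact (pow_le_pow_left₀ (norm_nonneg _) hs 2).trans_eq (by ring)
    _ = a ^ 2 * x ^ 2 + b ^ 2 * y ^ 2 + 2 * a * b * ∫ s, ‖g s‖ * ‖h s‖ ∂Pr
        + 2 * a * c * ∫ s, ‖g s‖ ∂Pr + 2 * b * c * ∫ s, ‖h s‖ ∂Pr + c ^ 2 := by
        rw [integral_add i4 (integrable_const _), integral_add i3 (hh1.const_mul _),
          integral_add i2 (hg1.const_mul _), integral_add i1 (hgh.const_mul _),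
          integral_add (hg2.const_mul _) (hh2.const_mul _)]
        simp only [integral_const_mul, integral_const, probReal_univ, one_smul]
        rw [lpNorm_two_sq hg, lpNorm_two_sq hh]
    _ ≤ a ^ 2 * x ^ 2 + b ^ 2 * y ^ 2 + 2 * a * b * (x * y)
        + 2 * a * c * x + 2 * b * c * y + c ^ 2 := by gcongr
    _ = (a * x + b * y + c) ^ 2 := by ring

end SecondMoment

/-! ### Freezing an independent variable -/

section Freezing

variable {S A B : Type*} [MeasurableSpace S] [MeasurableSpace A] [MeasurableSpace B]
  {Pr : Measure S} [IsProbabilityMeasure Pr] {Y : S → A} {N : S → B} {ν : Measure B}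
  {φ : A × B → ℝ}

/-- Independence makes the joint law a product, so Fubini applies. -/
theorem integral_comp_of_indepFun (hY : Measurable Y) (hN : HasLaw N ν Pr)
    (hind : IndepFun Y N Pr) (hφ : Measurable φ)
    (hint : Integrable (fun s => φ (Y s, N s)) Pr) :
    Integrable (fun s => ∫ z, φ (Y s, z) ∂ν) Pr ∧
      ∫ s, φ (Y s, N s) ∂Pr = ∫ s, ∫ z, φ (Y s, z) ∂ν ∂Pr := by
  have hNm := hN.aemeasurable
  have hmap := (indepFun_iff_map_prod_eq_prod_map_map hY.aemeasurable hNm).1 hind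
  rw [hN.map_eq] at hmap
  have : IsProbabilityMeasure ν := hN.isProbabilityMeasure_iff.1 inferInstance
  have : IsProbabilityMeasure (Pr.map Y) := Measure.isProbabilityMeasure_map hY.aemeasurable
  have hYN : AEMeasurable (fun s => (Y s, N s)) Pr := hY.aemeasurable.prodMk hNm
  have hint' : Integrable φ ((Pr.map Y).prod ν) := by
    rw [← hmap]
    exact (integrable_map_measure hφ.aestronglyMeasurable hYN).2 hint
  have hsm : StronglyMeasurable fun y => ∫ z, φ (y, z) ∂ν :=
    hφ.stronglyMeasurable.integral_prod_right'
  refine ⟨hint'.integral_prod_left.comp_measurable hY, ?_⟩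
  rw [← integral_map (f := φ) hYN hφ.aestronglyMeasurable, hmap, integral_prod _ hint',
    integral_map hY.aemeasurable hsm.aestronglyMeasurable]

/-- For nonnegative `φ`, Tonelli also yields integrability from the bound on the inner integrals.
The compression error needs this, since it has no almost sure bound. -/
theorem integral_comp_le_of_indepFun (hY : Measurable Y) (hN : HasLaw N ν Pr)
    (hind : IndepFun Y N Pr) (hφ : Measurable φ) (hφ0 : ∀ p, 0 ≤ φ p) {κ : A → ℝ}
    (hφi : ∀ y, Integrable (fun z => φ (y, z)) ν) (hκ : ∀ y, ∫ z, φ (y, z) ∂ν ≤ κ y)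
    (hκi : Integrable (fun s => κ (Y s)) Pr) :
    Integrable (fun s => φ (Y s, N s)) Pr ∧
      ∫ s, φ (Y s, N s) ∂Pr ≤ ∫ s, κ (Y s) ∂Pr := by
  have hNm := hN.aemeasurable
  have hmap := (indepFun_iff_map_prod_eq_prod_map_map hY.aemeasurable hNm).1 hind
  rw [hN.map_eq] at hmap
  have : IsProbabilityMeasure ν := hN.isProbabilityMeasure_iff.1 inferInstance
  have : IsProbabilityMeasure (Pr.map Y) := Measure.isProbabilityMeasure_map hY.aemeasurable
  have hYN : AEMeasurable (fun s => (Y s, N s)) Pr := hY.aemeasurable.prodMk hNm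
  have hsm : StronglyMeasurable fun y => ∫ z, φ (y, z) ∂ν :=
    hφ.stronglyMeasurable.integral_prod_right'
  have hbd : Integrable (fun s => ∫ z, φ (Y s, z) ∂ν) Pr :=
    hκi.mono' (hsm.measurable.comp hY).aestronglyMeasurable (.of_forall fun s => by
      rw [Real.norm_of_nonneg (integral_nonneg fun _ => hφ0 _)]; exact hκ _)
  have hint : Integrable (fun s => φ (Y s, N s)) Pr := by
    refine (integrable_map_measure (f := fun s => (Y s, N s)) hφ.aestronglyMeasurable hYN).1 ?_
    rw [hmap, integrable_prod_iff hφ.aestronglyMeasurable]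
    refine ⟨.of_forall hφi, ?_⟩
    simp only [Real.norm_of_nonneg (hφ0 _)]
    exact (integrable_map_measure hsm.aestronglyMeasurable hY.aemeasurable).2 hbd
  refine ⟨hint, ?_⟩
  rw [(integral_comp_of_indepFun hY hN hind hφ hint).2]
  exact integral_mono hbd hκi fun s => hκ _

end Freezing

/-! ### Filtration of the run -/

section Run

variable {n d : ℕ} {X : Fin n → Type u} {Z : Type v} {S : Type w}
  {ξ : ∀ i, ℕ → S → X i} {dir : Fin n → ℕ → S → E d} {ζ : Fin n → ℕ → S → Z}
variable {W : Matrix (Fin n) (Fin n) ℝ} {Om : Set (E d)} {F : ∀ i, E d → X i → ℝ}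
  {C : E d → Z → E d} {μ ε ψ γ : ℝ} {η : ℕ → ℝ} {x₀ : Fin n → E d}

variable (W Om F C μ ε ψ γ η x₀ ξ dir ζ) in
/-- The random run of the algorithm. -/
noncomputable def run (k : ℕ) (s : S) : State n d :=
  comDSZO W Om F C μ ε ψ γ η x₀ (fun i k => ξ i k s) (fun i k => dir i k s)
    (fun i k => ζ i k s) k

local notation "𝓡" => run ξ dir ζ W Om F C μ ε ψ γ η x₀

/-- The initial message fits the general formula because `xhat` starts at zero. -/
theorem run_q (k : ℕ) (s : S) (i : Fin n) :
    (𝓡 k s).q i = C ((𝓡 k s).x i - (𝓡 k s).xhat i) (ζ i k s) := by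
  cases k with
  | zero => simp [run, comDSZO]
  | succ k => rfl

theorem run_succ_xhat (k : ℕ) (s : S) (i : Fin n) :
    (𝓡 (k + 1) s).xhat i = (𝓡 k s).xhat i + ψ • (𝓡 k s).q i := rfl

theorem run_succ_x (k : ℕ) (s : S) (i : Fin n) :
    (𝓡 (k + 1) s).x i = proj (shrink Om ε) ((𝓡 k s).x i - γ • (𝓡 (k + 1) s).b i
      - η k • gradEst (F i) μ ((𝓡 k s).x i) (dir i k s) (ξ i k s)) := rfl

theorem run_succ_b (k : ℕ) (s : S) (i : Fin n) :
    (𝓡 (k + 1) s).b i = (𝓡 k s).b i + ψ • ((𝓡 k s).q i - ∑ j, W i j • (𝓡 k s).q j) := rfl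

/-- Both sides start at zero and have the same increments, by linearity of mixing. -/
theorem run_b (k : ℕ) (s : S) (i : Fin n) :
    (𝓡 k s).b i = mix (1 - W) (WithLp.toLp 2 (𝓡 k s).xhat) i := by
  induction k generalizing i with
  | zero =>
    have : (WithLp.toLp 2 (𝓡 0 s).xhat : Stack n d) = 0 := rfl
    rw [this, map_zero]; rfl
  | succ k ih =>
    have h : (WithLp.toLp 2 (𝓡 (k + 1) s).xhat : Stack n d)
        = WithLp.toLp 2 (𝓡 k s).xhat + ψ • WithLp.toLp 2 (𝓡 k s).q := rfl
    rw [run_succ_b, ih, h, map_add, map_smul, mix_sub 1 W (WithLp.toLp 2 (𝓡 k s).q), mix_one]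
    rfl

variable [∀ i, MeasurableSpace (X i)] [MeasurableSpace Z]

/-- The events determined by the random inputs of the iterations before `k`. -/
@[reducible] def past (ξ : ∀ i, ℕ → S → X i) (dir : Fin n → ℕ → S → E d) (ζ : Fin n → ℕ → S → Z) (k : ℕ) :
    MeasurableSpace S :=
  ⨆ p ∈ {p : Fin n × ℕ | p.2 < k},
    MeasurableSpace.comap (fun s => (ξ p.1 p.2 s, dir p.1 p.2 s, ζ p.1 p.2 s)) inferInstance

theorem past_mono : Monotone (past ξ dir ζ) := fun _ _ hkl =>
  biSup_mono fun _ hp => lt_of_lt_of_le hp hkl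

theorem measurable_noise_past {i : Fin n} {j k : ℕ} (hjk : j < k) :
    Measurable[past ξ dir ζ k] fun s => (ξ i j s, dir i j s, ζ i j s) := by
  refine Measurable.of_comap_le ?_
  exact le_iSup₂_of_le (f := fun (p : Fin n × ℕ) (_ : p ∈ {p : Fin n × ℕ | p.2 < k}) =>
    MeasurableSpace.comap (fun s => (ξ p.1 p.2 s, dir p.1 p.2 s, ζ p.1 p.2 s)) inferInstance)
    (i, j) hjk le_rfl

theorem measurable_gradEst {X : Type*} [MeasurableSpace X] {F : E d → X → ℝ}
    (hF : Measurable fun p : E d × X => F p.1 p.2) (μ : ℝ) :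
    Measurable fun p : E d × X × E d => gradEst F μ p.1 p.2.2 p.2.1 := by
  unfold gradEst
  have h1 : Measurable fun p : E d × X × E d => F (p.1 + μ • p.2.2) p.2.1 :=
    hF.comp ((measurable_fst.add (measurable_snd.snd.const_smul μ)).prodMk measurable_snd.fst)
  have h2 : Measurable fun p : E d × X × E d => F p.1 p.2.1 :=
    hF.comp (measurable_fst.prodMk measurable_snd.fst)
  exact (measurable_const.mul (h1.sub h2)).smul measurable_snd.snd

theorem Measurable.gradEst {A X : Type*} [MeasurableSpace A] [MeasurableSpace X]
    {F : E d → X → ℝ} (hF : Measurable fun p : E d × X => F p.1 p.2) (μ : ℝ) {x v : A → E d}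
    {ξ : A → X} (hx : Measurable x) (hv : Measurable v) (hξ : Measurable ξ) :
    Measurable fun a => _root_.gradEst F μ (x a) (v a) (ξ a) :=
  have h : Measurable fun a => (x a, ξ a, v a) := hx.prodMk (hξ.prodMk hv)
  have h' := (measurable_gradEst hF μ).comp h
  h'

/-- The σ-algebra on `S` is arbitrary so that it can be a `past`. The message `q` is omitted from
the conclusion: it already uses the compressor randomness of its own iteration. -/
theorem measurable_run_succ [MeasurableSpace S] (hproj : Measurable (proj (shrink Om ε)))
    (hF : ∀ i, Measurable fun p : E d × X i => F i p.1 p.2)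
    (hC : Measurable fun p : E d × Z => C p.1 p.2) {k : ℕ}
    (hN : ∀ i, Measurable fun s => (ξ i k s, dir i k s, ζ i k s))
    (hx : ∀ i, Measurable fun s => (𝓡 k s).x i) (hxh : ∀ i, Measurable fun s => (𝓡 k s).xhat i)
    (hb : ∀ i, Measurable fun s => (𝓡 k s).b i) (i : Fin n) :
    Measurable (fun s => (𝓡 (k + 1) s).x i) ∧ Measurable (fun s => (𝓡 (k + 1) s).xhat i) ∧
      Measurable (fun s => (𝓡 (k + 1) s).b i) := by
  have hq : ∀ i, Measurable fun s => (𝓡 k s).q i := fun i => by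
    simp only [run_q]
    exact hC.comp (((hx i).sub (hxh i)).prodMk (hN i).snd.snd)
  have hb' : ∀ i, Measurable fun s => (𝓡 (k + 1) s).b i := fun i => by
    simp only [run_succ_b]
    have h1 : Measurable fun s => ∑ j, W i j • (𝓡 k s).q j :=
      Finset.measurable_fun_sum _ fun j _ => (hq j).const_smul (W i j)
    exact (hb i).add (((hq i).sub h1).const_smul ψ)
  refine ⟨?_, ?_, hb' i⟩
  · simp only [run_succ_x]
    have h1 : Measurable fun s => gradEst (F i) μ ((𝓡 k s).x i) (dir i k s) (ξ i k s) :=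
      Measurable.gradEst (hF i) μ (hx i) (hN i).snd.fst (hN i).fst
    exact hproj.comp (((hx i).sub ((hb' i).const_smul γ)).sub (h1.const_smul (η k)))
  · simp only [run_succ_xhat]
    exact (hxh i).add ((hq i).const_smul ψ)

/-- The iterates are determined by the random inputs of the earlier iterations. -/
theorem measurable_run_past (hproj : Measurable (proj (shrink Om ε)))
    (hF : ∀ i, Measurable fun p : E d × X i => F i p.1 p.2)
    (hC : Measurable fun p : E d × Z => C p.1 p.2) (k : ℕ) (i : Fin n) :
    Measurable[past ξ dir ζ k] (fun s => (𝓡 k s).x i) ∧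
      Measurable[past ξ dir ζ k] (fun s => (𝓡 k s).xhat i) ∧
      Measurable[past ξ dir ζ k] (fun s => (𝓡 k s).b i) := by
  induction k generalizing i with
  | zero => exact ⟨measurable_const, measurable_const, measurable_const⟩
  | succ k ih =>
    have hle : past ξ dir ζ k ≤ past ξ dir ζ (k + 1) := past_mono (Nat.le_succ k)
    exact @measurable_run_succ n d X Z S ξ dir ζ W Om F C μ ε ψ γ η x₀ _ _ (past ξ dir ζ (k + 1))
      hproj hF hC k (fun i => measurable_noise_past (Nat.lt_succ_self k))
      (fun i => (ih i).1.mono hle le_rfl) (fun i => (ih i).2.1.mono hle le_rfl)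
      (fun i => (ih i).2.2.mono hle le_rfl) i

variable [MeasurableSpace S] {Pr : Measure S} {P : ∀ i, Measure (X i)} {ν : Measure Z}

theorem IsNoise.past_le (h : IsNoise Pr P ν ξ dir ζ) (k : ℕ) :
    past ξ dir ζ k ≤ ‹MeasurableSpace S› :=
  iSup₂_le fun p _ => (h.measurable p.1 p.2).comap_le

/-- The index sets `{p | p.2 < k}` and `{(i, k)}` are disjoint. -/
theorem IsNoise.indepFun_past (h : IsNoise Pr P ν ξ dir ζ) {A : Type*} [MeasurableSpace A]
    {Y : S → A} {k : ℕ} (hY : Measurable[past ξ dir ζ k] Y) (i : Fin n) :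
    IndepFun Y (fun s => (ξ i k s, dir i k s, ζ i k s)) Pr := by
  rw [IndepFun_iff_Indep]
  have hind := indep_iSup_of_disjoint (fun p : Fin n × ℕ => (h.measurable p.1 p.2).comap_le)
    h.indep (S := {p | p.2 < k}) (T := {(i, k)}) (by simp)
  refine indep_of_indep_of_le_left (indep_of_indep_of_le_right hind ?_) hY.comap_le
  simp

end Run

/-! ### Laws of the individual random inputs -/

section Laws

variable {n d : ℕ} {X : Fin n → Type u} [∀ i, MeasurableSpace (X i)] {Z : Type v}
  [MeasurableSpace Z] {S : Type w} [MeasurableSpace S] {Pr : Measure S}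
  {P : ∀ i, Measure (X i)} [∀ i, IsProbabilityMeasure (P i)] {ν : Measure Z}
  [IsProbabilityMeasure ν]
  {ξ : ∀ i, ℕ → S → X i} {dir : Fin n → ℕ → S → E d} {ζ : Fin n → ℕ → S → Z}

theorem IsNoise.hasLaw_sample (h : IsNoise Pr P ν ξ dir ζ) (hd : 1 ≤ d) (i : Fin n) (k : ℕ) :
    HasLaw (fun s => (ξ i k s, dir i k s)) ((P i).prod (sphereUniform d)) Pr := by
  have := isProbabilityMeasure_sphereUniform hd
  refine ⟨((h.measurable i k).fst.prodMk (h.measurable i k).snd.fst).aemeasurable, ?_⟩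
  have hm : Measurable (Prod.map (id : X i → X i) (Prod.fst : E d × Z → E d)) :=
    measurable_id.prodMap measurable_fst
  have h1 := Measure.map_map (μ := Pr) hm (h.measurable i k)
  rw [(h.law i k).map_eq, ← Measure.map_prod_map _ _ measurable_id measurable_fst,
    Measure.map_id, Measure.map_fst_prod, measure_univ, one_smul] at h1
  exact h1.symm

theorem IsNoise.hasLaw_compressor (h : IsNoise Pr P ν ξ dir ζ) (hd : 1 ≤ d) (i : Fin n) (k : ℕ) :
    HasLaw (ζ i k) ν Pr := by
  have := isProbabilityMeasure_sphereUniform hd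
  refine ⟨(h.measurable i k).snd.snd.aemeasurable, ?_⟩
  have h1 := Measure.map_map (μ := Pr) (measurable_snd.comp measurable_snd) (h.measurable i k)
  rw [(h.law i k).map_eq, ← Measure.map_map measurable_snd measurable_snd, Measure.map_snd_prod,
    measure_univ, one_smul, Measure.map_snd_prod, measure_univ, one_smul] at h1
  exact h1.symm

theorem IsNoise.ae_sample (h : IsNoise Pr P ν ξ dir ζ) (hd : 1 ≤ d) (i : Fin n) (k : ℕ)
    {p : X i → Prop} (hp : ∀ᵐ a ∂P i, p a) : ∀ᵐ s ∂Pr, p (ξ i k s) ∧ ‖dir i k s‖ = 1 := by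
  have := isProbabilityMeasure_sphereUniform hd
  have hl := h.hasLaw_sample hd i k
  refine ae_of_ae_map (p := fun q : X i × E d => p q.1 ∧ ‖q.2‖ = 1) hl.aemeasurable ?_
  rw [hl.map_eq]
  exact (Measure.quasiMeasurePreserving_fst.ae hp).and
    (Measure.quasiMeasurePreserving_snd.ae ae_norm_eq_one_sphereUniform)

end Laws

/-! ### Oracle and compressor -/

section Oracle

/-- The Lipschitz increment is at most `Lμ`, which cancels `1 / μ`; the bound is uniform in the
smoothing radius. -/
theorem norm_gradEst_le {d : ℕ} {X : Type u} {Om : Set (E d)} {L : ℝ} {F : E d → X → ℝ} {ξ : X}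
    (hF : ∀ x ∈ Om, ∀ y ∈ Om, |F x ξ - F y ξ| ≤ L * ‖x - y‖) {μ : ℝ} (hμ : 0 < μ) {x v : E d}
    (hx : x ∈ Om) (hxv : x + μ • v ∈ Om) (hv : ‖v‖ = 1) : ‖gradEst F μ x v ξ‖ ≤ d * L := by
  have h1 := hF _ hxv _ hx
  rw [add_sub_cancel_left, norm_smul, hv, mul_one, Real.norm_of_nonneg hμ.le] at h1
  rw [gradEst, norm_smul, hv, mul_one, Real.norm_eq_abs, abs_mul,
    abs_of_nonneg (by positivity)]
  calc (d : ℝ) / μ * |F (x + μ • v) ξ - F x ξ| ≤ d / μ * (L * μ) := by gcongr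
    _ = d * L := by field_simp

variable {d : ℕ} {X : Type u} [MeasurableSpace X] {Om : Set (E d)} {L : ℝ} {P : Measure X}
  {F : E d → X → ℝ}

theorem IsOracle.abs_integral_sub_le [IsProbabilityMeasure P] (h : IsOracle Om L P F) {x y : E d}
    (hx : x ∈ Om) (hy : y ∈ Om) : |∫ ξ, F x ξ ∂P - ∫ ξ, F y ξ ∂P| ≤ L * ‖x - y‖ := by
  rw [← integral_sub (h.integrable x hx) (h.integrable y hy), ← Real.norm_eq_abs]
  have := norm_integral_le_of_norm_le_const (μ := P) (f := fun ξ => F x ξ - F y ξ)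
    (C := L * ‖x - y‖) (by filter_upwards [h.lipschitz] with ξ hξ using hξ x hx y hy)
  simpa using this

theorem IsOracle.measurable_integral [SFinite P] (h : IsOracle Om L P F) :
    Measurable fun x => ∫ ξ, F x ξ ∂P :=
  (StronglyMeasurable.integral_prod_right (f := F) h.measurable.stronglyMeasurable).measurable

theorem IsOracle.integral_inner_gradEst_ge [IsProbabilityMeasure P] (h : IsOracle Om L P F)
    (hd : 1 ≤ d) (hL : 0 ≤ L) {μ : ℝ} (hμ : 0 < μ) {x y : E d}
    (hx : ∀ z : E d, ‖z‖ ≤ μ → x + z ∈ Om) (hy : ∀ z : E d, ‖z‖ ≤ μ → y + z ∈ Om) :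
    ∫ ξ, F x ξ ∂P - ∫ ξ, F y ξ ∂P - 2 * L * μ
      ≤ ∫ p, inner ℝ (x - y) (gradEst F μ x p.2 p.1) ∂P.prod (sphereUniform d) := by
  have := isProbabilityMeasure_sphereUniform hd
  have hx0 : x ∈ Om := by simpa using hx 0 (by simpa using hμ.le)
  have hy0 : y ∈ Om := by simpa using hy 0 (by simpa using hμ.le)
  have hmeas : Measurable fun p : X × E d => inner ℝ (x - y) (gradEst F μ x p.2 p.1) :=
    measurable_const.inner (Measurable.gradEst h.measurable μ measurable_const measurable_snd
      measurable_fst)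
  have hint : Integrable (fun p : X × E d => inner ℝ (x - y) (gradEst F μ x p.2 p.1))
      (P.prod (sphereUniform d)) := by
    refine Integrable.of_bound hmeas.aestronglyMeasurable (‖x - y‖ * (d * L)) ?_
    filter_upwards [Measure.quasiMeasurePreserving_fst.ae h.lipschitz,
      Measure.quasiMeasurePreserving_snd.ae ae_norm_eq_one_sphereUniform] with p hp1 hp2
    refine (norm_inner_le_norm _ _).trans (mul_le_mul_of_nonneg_left ?_ (norm_nonneg _))
    exact norm_gradEst_le hp1 hμ hx0
      (hx _ (by rw [norm_smul, hp2, mul_one, Real.norm_of_nonneg hμ.le])) hp2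
  rw [integral_prod _ hint, ← integral_sub (h.integrable x hx0) (h.integrable y hy0)]
  have h1 : ∫ ξ, (F x ξ - F y ξ) ∂P - 2 * L * μ = ∫ ξ, (F x ξ - F y ξ - 2 * L * μ) ∂P := by
    have h2 : Integrable (fun ξ => F x ξ - F y ξ) P := (h.integrable x hx0).sub (h.integrable y hy0)
    rw [integral_sub h2 (integrable_const _)]
    simp
  rw [h1]
  refine integral_mono_ae (((h.integrable x hx0).sub (h.integrable y hy0)).sub
    (integrable_const _)) hint.integral_prod_left ?_
  filter_upwards [h.lipschitz, h.convex] with ξ hξ1 hξ2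
  have h2 := sphere_estimator_subgradient hd hL hμ hξ2 hξ1 hx hy
  have h3 : ∫ v, inner ℝ (x - y) (gradEst F μ x v ξ) ∂sphereUniform d
      = -(d / μ * ∫ v, (F (x + μ • v) ξ - F x ξ) * inner ℝ v (y - x) ∂sphereUniform d) := by
    rw [← integral_const_mul, ← integral_neg]
    refine integral_congr_ae (.of_forall fun v => ?_)
    simp only [gradEst, inner_smul_right]
    rw [real_inner_comm, ← neg_sub y x, inner_neg_right]
    ring
  rw [h3]
  linarith

/-- The residual is the convex combination of `e` and `e - C e / r` with weights `1 - ψr` and `ψr`;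
convexity of the squared norm gives the rate. -/
theorem IsCompressor.residual {Z : Type v} [MeasurableSpace Z] {ν : Measure Z}
    [IsProbabilityMeasure ν] {C : E d → Z → E d} {r ω ψ : ℝ} (h : IsCompressor ν C r ω)
    (hr : 0 < r) (hψ : 0 ≤ ψ) (hψr : ψ * r ≤ 1) (e : E d) :
    Integrable (fun z => ‖e - ψ • C e z‖ ^ 2) ν ∧
      ∫ z, ‖e - ψ • C e z‖ ^ 2 ∂ν ≤ (1 - ψ * r * ω) * ‖e‖ ^ 2 := by
  have hpt : ∀ z, ‖e - ψ • C e z‖ ^ 2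
      ≤ (1 - ψ * r) * ‖e‖ ^ 2 + ψ * r * ‖(1 / r) • C e z - e‖ ^ 2 := fun z => by
    have h1 : e - ψ • C e z = (1 - ψ * r) • e + (ψ * r) • (e - (1 / r) • C e z) := by
      rw [smul_sub, smul_smul, mul_assoc, mul_one_div_cancel hr.ne', mul_one]; module
    have h0 : 0 ≤ ψ * r := by positivity
    have h2 : ‖e - ψ • C e z‖ ≤ (1 - ψ * r) * ‖e‖ + ψ * r * ‖(1 / r) • C e z - e‖ := by
      rw [h1, norm_sub_rev _ e]
      refine (norm_add_le _ _).trans_eq ?_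
      rw [norm_smul, norm_smul, Real.norm_of_nonneg h0, Real.norm_of_nonneg (by linarith)]
    refine (pow_le_pow_left₀ (norm_nonneg _) h2 2).trans ?_
    nlinarith [mul_nonneg (mul_nonneg h0 (sub_nonneg.2 hψr))
      (sq_nonneg (‖e‖ - ‖(1 / r) • C e z - e‖))]
  have hi : Integrable (fun z => (1 - ψ * r) * ‖e‖ ^ 2 + ψ * r * ‖(1 / r) • C e z - e‖ ^ 2) ν :=
    (integrable_const _).add ((h.integrable e).const_mul _)
  have hm : Measurable fun z => ‖e - ψ • C e z‖ ^ 2 := by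
    have : Measurable fun z => C e z := h.measurable.comp (measurable_const.prodMk measurable_id)
    exact ((measurable_const.sub (this.const_smul ψ)).norm).pow_const 2
  have hi' : Integrable (fun z => ‖e - ψ • C e z‖ ^ 2) ν :=
    hi.mono' hm.aestronglyMeasurable (.of_forall fun z => by
      rw [Real.norm_of_nonneg (sq_nonneg _)]; exact hpt z)
  refine ⟨hi', (integral_mono hi' hi hpt).trans ?_⟩
  rw [integral_add (integrable_const _) ((h.integrable e).const_mul _), integral_const,
    probReal_univ, one_smul, integral_const_mul (μ := ν) (ψ * r)]
  have := mul_le_mul_of_nonneg_left (h.bound e) (by positivity : 0 ≤ ψ * r)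
  linarith

end Oracle

/-! ### The random run -/

theorem stack_norm_sq {n d : ℕ} (X : Stack n d) : ‖X‖ ^ 2 = ∑ i, ‖X i‖ ^ 2 :=
  PiLp.norm_sq_eq_of_L2 _ X

theorem two_mul_sqrt_mul_sq (n : ℕ) (R : ℝ) : (2 * √(n : ℝ) * R) ^ 2 = n * (2 * R) ^ 2 := by
  rw [mul_pow, mul_pow, Real.sq_sqrt (Nat.cast_nonneg _)]; ring

theorem MeasureTheory.MemLp.integrable_real_inner {S : Type*} [MeasurableSpace S]
    {Pr : Measure S} {V : Type*} [NormedAddCommGroup V] [InnerProductSpace ℝ V] {f g : S → V}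
    (hf : MemLp f 2 Pr) (hg : MemLp g 2 Pr) : Integrable (fun s => inner ℝ (f s) (g s)) Pr := by
  refine (hf.norm.integrable_mul hg.norm).mono' (hf.1.inner hg.1) (.of_forall fun s => ?_)
  exact norm_inner_le_norm _ _

section Trajectory

variable {n d : ℕ} {X : Fin n → Type u} {Z : Type v} {S : Type w}
  {ξ : ∀ i, ℕ → S → X i} {dir : Fin n → ℕ → S → E d} {ζ : Fin n → ℕ → S → Z}
  {W : Matrix (Fin n) (Fin n) ℝ} {Om : Set (E d)} {F : ∀ i, E d → X i → ℝ}
  {C : E d → Z → E d} {μ ε ψ γ : ℝ} {η : ℕ → ℝ} {x₀ : Fin n → E d}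

local notation "𝓡" => run ξ dir ζ W Om F C μ ε ψ γ η x₀

variable (ξ dir ζ W Om F C μ ε ψ γ η x₀) in
/-- The stacked iterates. -/
noncomputable def runX (k : ℕ) (s : S) : Stack n d :=
  WithLp.toLp 2 (run ξ dir ζ W Om F C μ ε ψ γ η x₀ k s).x

variable (ξ dir ζ W Om F C μ ε ψ γ η x₀) in
/-- The stacked compressed estimates. -/
noncomputable def runXhat (k : ℕ) (s : S) : Stack n d :=
  WithLp.toLp 2 (run ξ dir ζ W Om F C μ ε ψ γ η x₀ k s).xhat

variable (ξ dir ζ W Om F C μ ε ψ γ η x₀) in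
/-- The stacked gradient estimators. -/
noncomputable def runG (k : ℕ) (s : S) : Stack n d :=
  WithLp.toLp 2 fun i =>
    gradEst (F i) μ ((run ξ dir ζ W Om F C μ ε ψ γ η x₀ k s).x i) (dir i k s) (ξ i k s)

local notation "𝓧" => runX ξ dir ζ W Om F C μ ε ψ γ η x₀
local notation "𝓨" => runXhat ξ dir ζ W Om F C μ ε ψ γ η x₀
local notation "𝓖" => runG ξ dir ζ W Om F C μ ε ψ γ η x₀

variable [∀ i, MeasurableSpace (X i)] [MeasurableSpace Z] [MeasurableSpace S]

/-- The standing assumptions on the network, the problem, the compressor, the parameters and the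
random inputs. -/
structure Setting (G : SimpleGraph (Fin n)) (W : Matrix (Fin n) (Fin n) ℝ) (Om : Set (E d))
    (L Rlo Rhi : ℝ) (P : ∀ i, Measure (X i)) (F : ∀ i, E d → X i → ℝ) (ν : Measure Z)
    (C : E d → Z → E d) (r ω μ ε ψ γ : ℝ) (η : ℕ → ℝ) (x₀ : Fin n → E d) (Pr : Measure S)
    (ξ : ∀ i, ℕ → S → X i) (dir : Fin n → ℕ → S → E d) (ζ : Fin n → ℕ → S → Z) : Prop where
  weight : IsWeightMatrix G W
  gap_nonneg : 0 ≤ specGap W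
  one_le_dim : 1 ≤ d
  lipschitz_pos : 0 < L
  inner_pos : 0 < Rlo
  outer_pos : 0 < Rhi
  constraint : IsConstraintSet Om Rlo Rhi
  probP : ∀ i, IsProbabilityMeasure (P i)
  oracle : ∀ i, IsOracle Om L (P i) (F i)
  probν : IsProbabilityMeasure ν
  compressor : IsCompressor ν C r ω
  scaling_pos : 0 < r
  psi_nonneg : 0 ≤ ψ
  psi_mul_le : ψ * r ≤ 1
  rate_le : ψ * r * ω ≤ 1
  gamma_nonneg : 0 ≤ γ
  gamma_le : γ ≤ 1
  mu_pos : 0 < μ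
  eps_pos : 0 < ε
  eps_le : ε ≤ 1
  mu_le : μ ≤ ε * Rlo
  step_nonneg : ∀ k, 0 ≤ η k
  init_mem : ∀ i, x₀ i ∈ Om
  probPr : IsProbabilityMeasure Pr
  noise : IsNoise Pr P ν ξ dir ζ

variable {G : SimpleGraph (Fin n)} {L Rlo Rhi : ℝ} {P : ∀ i, Measure (X i)} {ν : Measure Z}
  {r ω : ℝ} {Pr : Measure S}

namespace Setting

variable (h : Setting G W Om L Rlo Rhi P F ν C r ω μ ε ψ γ η x₀ Pr ξ dir ζ)

include h

theorem shrink_nonempty : (shrink Om ε).Nonempty := h.constraint.shrink_nonempty h.inner_pos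

theorem shrink_subset : shrink Om ε ⊆ Om :=
  h.constraint.shrink_subset h.inner_pos h.eps_pos h.eps_le

theorem add_mem {x z : E d} (hx : x ∈ shrink Om ε) (hz : ‖z‖ ≤ μ) : x + z ∈ Om :=
  h.constraint.add_mem_of_mem_shrink h.eps_pos h.eps_le hx (hz.trans h.mu_le)

theorem x_mem_shrink {k : ℕ} (hk : 1 ≤ k) (s : S) (i : Fin n) :
    𝓧 k s i ∈ shrink Om ε := by
  obtain ⟨k, rfl⟩ := Nat.exists_eq_succ_of_ne_zero (Nat.one_le_iff_ne_zero.1 hk)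
  exact (proj_spec h.shrink_nonempty h.constraint.shrink_isClosed _).1

theorem x_mem (k : ℕ) (s : S) (i : Fin n) : 𝓧 k s i ∈ Om := by
  rcases Nat.eq_zero_or_pos k with rfl | hk
  · exact h.init_mem i
  · exact h.shrink_subset (h.x_mem_shrink hk s i)

theorem measurable_proj : Measurable (proj (shrink Om ε)) :=
  (continuous_proj h.shrink_nonempty h.constraint.shrink_isClosed
    h.constraint.shrink_convex).measurable

theorem measurable_past (k : ℕ) (i : Fin n) :
    Measurable[past ξ dir ζ k] (fun s => (𝓡 k s).x i) ∧
      Measurable[past ξ dir ζ k] (fun s => (𝓡 k s).xhat i) :=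
  have := measurable_run_past (ξ := ξ) (dir := dir) (ζ := ζ) (W := W) (γ := γ) (ψ := ψ) (η := η)
    (x₀ := x₀) (μ := μ) h.measurable_proj (fun i => (h.oracle i).measurable)
    h.compressor.measurable k i
  ⟨this.1, this.2.1⟩

theorem measurable_x (k : ℕ) (i : Fin n) : Measurable fun s => (𝓡 k s).x i :=
  (h.measurable_past k i).1.mono (h.noise.past_le k) le_rfl

theorem measurable_xhat (k : ℕ) (i : Fin n) : Measurable fun s => (𝓡 k s).xhat i :=
  (h.measurable_past k i).2.mono (h.noise.past_le k) le_rfl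

theorem measurable_runX (k : ℕ) : Measurable (𝓧 k) :=
  (WithLp.measurable_toLp 2 _).comp (measurable_pi_lambda _ fun i => h.measurable_x k i)

theorem measurable_runXhat (k : ℕ) : Measurable (𝓨 k) :=
  (WithLp.measurable_toLp 2 _).comp (measurable_pi_lambda _ fun i => h.measurable_xhat k i)

theorem measurable_gradEst_run (k : ℕ) (i : Fin n) :
    Measurable fun s => gradEst (F i) μ ((𝓡 k s).x i) (dir i k s) (ξ i k s) :=
  Measurable.gradEst (h.oracle i).measurable μ (h.measurable_x k i)
    (h.noise.measurable i k).snd.fst (h.noise.measurable i k).fst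

theorem measurable_runG (k : ℕ) : Measurable (𝓖 k) :=
  (WithLp.measurable_toLp 2 _).comp
    (measurable_pi_lambda _ fun i => h.measurable_gradEst_run k i)

omit [∀ i, MeasurableSpace (X i)] [MeasurableSpace Z] [MeasurableSpace S] h in
theorem _root_.runX_succ_apply (k : ℕ) (s : S) (i : Fin n) :
    𝓧 (k + 1) s i
      = proj (shrink Om ε) (𝓧 k s i - γ • mix (1 - W) (𝓨 (k + 1) s) i - η k • 𝓖 k s i) := by
  change (𝓡 (k + 1) s).x i = _
  rw [run_succ_x, run_b]
  rfl

/-- From iteration 1 on the iterates lie in the shrunk set, so the queried points stay in `Om`. -/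
theorem ae_gradEst_le {k : ℕ} (hk : 1 ≤ k) (i : Fin n) :
    ∀ᵐ s ∂Pr, ‖𝓖 k s i‖ ≤ d * L := by
  have := h.probP
  have := h.probν
  filter_upwards [h.noise.ae_sample h.one_le_dim i k (h.oracle i).lipschitz] with s hs
  refine norm_gradEst_le hs.1 h.mu_pos (h.x_mem k s i) (h.add_mem (h.x_mem_shrink hk s i) ?_) hs.2
  rw [norm_smul, hs.2, mul_one, Real.norm_of_nonneg h.mu_pos.le]

theorem ae_norm_runG_le {k : ℕ} (hk : 1 ≤ k) :
    ∀ᵐ s ∂Pr, ‖𝓖 k s‖ ≤ √(n : ℝ) * (d * L) := by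
  filter_upwards [ae_all_iff.2 fun i => h.ae_gradEst_le hk i] with s hs
  refine le_of_sq_le_sq ?_ (mul_nonneg (Real.sqrt_nonneg _)
    (mul_nonneg (Nat.cast_nonneg _) h.lipschitz_pos.le))
  rw [stack_norm_sq, mul_pow, Real.sq_sqrt (Nat.cast_nonneg _)]
  refine (Finset.sum_le_sum fun i _ => pow_le_pow_left₀ (norm_nonneg _) (hs i) 2).trans_eq ?_
  simp

theorem norm_runX_sub_consensus_le (k : ℕ) (s : S) {x : E d} (hx : x ∈ Om) :
    ‖𝓧 k s - consensusStack n x‖ ^ 2 ≤ n * (2 * Rhi) ^ 2 := by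
  rw [stack_norm_sq]
  refine (Finset.sum_le_sum fun i _ => pow_le_pow_left₀ (norm_nonneg _)
    (?_ : _ ≤ 2 * Rhi) 2).trans_eq (by simp)
  have h1 := h.constraint.norm_le (h.x_mem k s i)
  have h2 := h.constraint.norm_le hx
  rw [PiLp.sub_apply, consensusStack_apply]
  linarith [norm_sub_le (𝓧 k s i) x]

theorem norm_runX_succ_sub_le (k : ℕ) (s : S) :
    ‖𝓧 (k + 1) s - 𝓧 k s‖ ≤ 2 * √(n : ℝ) * Rhi := by
  have := h.outer_pos
  refine le_of_sq_le_sq ?_ (by positivity)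
  rw [two_mul_sqrt_mul_sq, stack_norm_sq]
  refine (Finset.sum_le_sum fun i _ => pow_le_pow_left₀ (norm_nonneg _)
    (?_ : _ ≤ 2 * Rhi) 2).trans_eq (by simp)
  have h1 := h.constraint.norm_le (h.x_mem k s i)
  have h2 := h.constraint.norm_le (h.x_mem (k + 1) s i)
  rw [PiLp.sub_apply]
  linarith [norm_sub_le (𝓧 (k + 1) s i) (𝓧 k s i)]

theorem norm_deviation_runX_le (k : ℕ) (s : S) :
    ‖deviation (𝓧 k s)‖ ≤ 2 * √(n : ℝ) * Rhi := by
  have := h.outer_pos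
  refine le_of_sq_le_sq ?_ (by positivity)
  rw [two_mul_sqrt_mul_sq]
  exact (pow_le_pow_left₀ (norm_nonneg _) (norm_deviation_le _ 0) 2).trans
    (h.norm_runX_sub_consensus_le k s (h.constraint.zero_mem h.inner_pos))

/-! ### Compression error -/

/-- `X - X̂` at time `k` is determined by the past and `ζ i k` is independent of it, so the
compressor bound holds after freezing the argument. -/
theorem compression_step (k : ℕ) (i : Fin n)
    (hint : Integrable (fun s => ‖(𝓧 k s - 𝓨 k s) i‖ ^ 2) Pr) :
    Integrable (fun s => ‖(𝓧 k s - 𝓨 (k + 1) s) i‖ ^ 2) Pr ∧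
      ∫ s, ‖(𝓧 k s - 𝓨 (k + 1) s) i‖ ^ 2 ∂Pr
        ≤ (1 - ψ * r * ω) * ∫ s, ‖(𝓧 k s - 𝓨 k s) i‖ ^ 2 ∂Pr := by
  have := h.probPr
  have := h.probP
  have := h.probν
  have hm := h.measurable_past k i
  have hY : Measurable fun s => (𝓡 k s).x i - (𝓡 k s).xhat i :=
    (h.measurable_x k i).sub (h.measurable_xhat k i)
  have hind : IndepFun (fun s => (𝓡 k s).x i - (𝓡 k s).xhat i) (ζ i k) Pr := by
    have h1 : Measurable[past ξ dir ζ k] fun s => (𝓡 k s).x i - (𝓡 k s).xhat i :=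
      measurable_sub.comp (hm.1.prodMk hm.2)
    have h2 := h.noise.indepFun_past h1 i
    exact h2.comp (φ := id) (ψ := fun p : X i × E d × Z => p.2.2) measurable_id
      (measurable_snd.comp measurable_snd)
  have hφ : Measurable fun p : E d × Z => ‖p.1 - ψ • C p.1 p.2‖ ^ 2 :=
    ((measurable_fst.sub (h.compressor.measurable.const_smul ψ)).norm).pow_const 2
  have key := integral_comp_le_of_indepFun (φ := fun p : E d × Z => ‖p.1 - ψ • C p.1 p.2‖ ^ 2)
    hY (h.noise.hasLaw_compressor h.one_le_dim i k)
    hind hφ (fun _ => sq_nonneg _) (κ := fun e => (1 - ψ * r * ω) * ‖e‖ ^ 2)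
    (fun e => (h.compressor.residual h.scaling_pos h.psi_nonneg h.psi_mul_le e).1)
    (fun e => (h.compressor.residual h.scaling_pos h.psi_nonneg h.psi_mul_le e).2)
    (hint.const_mul _)
  have heq : ∀ s, (𝓧 k s - 𝓨 (k + 1) s) i
      = ((𝓡 k s).x i - (𝓡 k s).xhat i)
        - ψ • C ((𝓡 k s).x i - (𝓡 k s).xhat i) (ζ i k s) := fun s => by
    have hq : (𝓡 k s).q i = C ((𝓡 k s).x i - (𝓡 k s).xhat i) (ζ i k s) := run_q k s i
    rw [← hq, PiLp.sub_apply]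
    change (𝓡 k s).x i - (𝓡 (k + 1) s).xhat i = _
    rw [run_succ_xhat]; abel
  simp only [heq]
  refine ⟨key.1, key.2.trans_eq ?_⟩
  exact integral_const_mul _ _

theorem memLp_of_bound {V : Type*} [NormedAddCommGroup V] {f : S → V}
    (hf : AEStronglyMeasurable f Pr) (M : ℝ) (hM : ∀ᵐ s ∂Pr, ‖f s‖ ≤ M) : MemLp f 2 Pr :=
  have := h.probPr
  MemLp.of_bound hf M hM

/-- Summed over the agents; the rate for norms comes from `1 - a ≤ (1 - a/2)²`. -/
theorem memLp_residual {k : ℕ} (hk : MemLp (fun s => 𝓧 k s - 𝓨 k s) 2 Pr) :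
    MemLp (fun s => 𝓧 k s - 𝓨 (k + 1) s) 2 Pr ∧
      lpNorm (fun s => 𝓧 k s - 𝓨 (k + 1) s) 2 Pr
        ≤ (1 - ψ * r * ω / 2) * lpNorm (fun s => 𝓧 k s - 𝓨 k s) 2 Pr := by
  have hmi : ∀ i, Integrable (fun s => ‖(𝓧 k s - 𝓨 k s) i‖ ^ 2) Pr := fun i => by
    refine (hk.integrable_norm_pow (by norm_num)).mono' ?_ (.of_forall fun s => ?_)
    · exact ((((h.measurable_x k i).sub (h.measurable_xhat k i)).norm).pow_const
        2).aestronglyMeasurable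
    · rw [Real.norm_of_nonneg (sq_nonneg _)]
      exact pow_le_pow_left₀ (norm_nonneg _) (PiLp.norm_apply_le _ i) 2
  have hs := fun i => h.compression_step k i (hmi i)
  have hmeas : Measurable fun s => 𝓧 k s - 𝓨 (k + 1) s :=
    (h.measurable_runX k).sub (h.measurable_runXhat (k + 1))
  have hm : MemLp (fun s => 𝓧 k s - 𝓨 (k + 1) s) 2 Pr := by
    rw [memLp_two_iff_integrable_sq_norm hmeas.aestronglyMeasurable]
    simp only [stack_norm_sq]
    exact integrable_finsetSum _ fun i _ => (hs i).1
  refine ⟨hm, le_of_sq_le_sq ?_ (mul_nonneg (by linarith [h.rate_le]) lpNorm_nonneg)⟩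
  rw [mul_pow, lpNorm_two_sq hm, lpNorm_two_sq hk]
  simp only [stack_norm_sq]
  rw [integral_finsetSum _ fun i _ => (hs i).1, integral_finsetSum _ fun i _ => hmi i]
  calc _ ≤ ∑ i, (1 - ψ * r * ω) * ∫ s, ‖(𝓧 k s - 𝓨 k s) i‖ ^ 2 ∂Pr :=
        Finset.sum_le_sum fun i _ => (hs i).2
    _ ≤ _ := by
        rw [← Finset.mul_sum]
        refine mul_le_mul_of_nonneg_right (by nlinarith [sq_nonneg (ψ * r * ω)])
          (Finset.sum_nonneg fun i _ => integral_nonneg fun _ => sq_nonneg _)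

theorem memLp_compression (k : ℕ) : MemLp (fun s => 𝓧 k s - 𝓨 k s) 2 Pr := by
  have := h.probPr
  induction k with
  | zero => exact memLp_const (WithLp.toLp 2 x₀ - WithLp.toLp 2 0 : Stack n d)
  | succ k ih =>
    have h1 : MemLp (fun s => 𝓧 (k + 1) s - 𝓧 k s) 2 Pr :=
      h.memLp_of_bound ((h.measurable_runX _).sub (h.measurable_runX _)).aestronglyMeasurable _
        (.of_forall fun s => h.norm_runX_succ_sub_le k s)
    refine (h1.add (h.memLp_residual ih).1).congr_norm ?_ (.of_forall fun s => ?_)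
    · exact ((h.measurable_runX _).sub (h.measurable_runXhat _)).aestronglyMeasurable
    · simp only [Pi.add_apply, sub_add_sub_cancel]

/-! ### Recursions in expectation -/

theorem measurable_deviation (k : ℕ) : Measurable fun s => deviation (𝓧 k s) := by
  have : Continuous (deviation (n := n) (d := d)) := by
    unfold deviation stackAvg consensusStack; fun_prop
  exact this.measurable.comp (h.measurable_runX k)

theorem memLp_deviation (k : ℕ) : MemLp (fun s => deviation (𝓧 k s)) 2 Pr :=
  h.memLp_of_bound (h.measurable_deviation k).aestronglyMeasurable _
    (.of_forall fun s => h.norm_deviation_runX_le k s)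

theorem lpNorm_deviation_le (k : ℕ) :
    lpNorm (fun s => deviation (𝓧 k s)) 2 Pr ≤ 2 * √(n : ℝ) * Rhi := by
  have := h.probPr
  have hR := h.outer_pos
  have h0 : MemLp (fun _ : S => (0 : ℝ)) 2 Pr := memLp_const 0
  have := lpNorm_two_le_of_ae_norm_le le_rfl le_rfl (by positivity) (h.memLp_deviation k) h0 h0
    (a := 0) (b := 0) (c := 2 * √(n : ℝ) * Rhi)
    (.of_forall fun s => by simpa using h.norm_deviation_runX_le k s)
  simpa using this

theorem lpNorm_deviation_succ_le {k : ℕ} (hk : 1 ≤ k) :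
    lpNorm (fun s => deviation (𝓧 (k + 1) s)) 2 Pr
      ≤ (1 - γ * specGap W) * lpNorm (fun s => deviation (𝓧 k s)) 2 Pr
        + γ * lapNorm W * ((1 - ψ * r * ω / 2) * lpNorm (fun s => 𝓧 k s - 𝓨 k s) 2 Pr)
        + η k * (√(n : ℝ) * (d * L)) := by
  have := h.probPr
  obtain ⟨h1, h2⟩ := h.memLp_residual (h.memLp_compression k)
  have hη := h.step_nonneg k
  have hγβ : 0 ≤ γ * lapNorm W := mul_nonneg h.gamma_nonneg lapNorm_nonneg
  have hL := h.lipschitz_pos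
  have hγδ : γ * specGap W ≤ 1 := by
    nlinarith [h.gamma_nonneg, h.gamma_le, h.gap_nonneg, specGap_le_one (W := W)]
  have key := lpNorm_two_le_of_ae_norm_le (a := 1 - γ * specGap W) (b := γ * lapNorm W)
    (c := η k * (√(n : ℝ) * (d * L))) (by linarith) hγβ (by positivity)
    (h.memLp_deviation (k + 1)) (h.memLp_deviation k) h1 (by
      filter_upwards [h.ae_norm_runG_le hk] with s hs
      refine (norm_deviation_step_le h.weight h.shrink_nonempty h.constraint.shrink_isClosed
        h.constraint.shrink_convex (h.x_mem_shrink hk s) (runX_succ_apply k s) h.gamma_nonneg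
        h.gamma_le hη).trans ?_
      gcongr)
  exact key.trans (by gcongr)

theorem lpNorm_compression_succ_le {k : ℕ} (hk : 1 ≤ k) :
    lpNorm (fun s => 𝓧 (k + 1) s - 𝓨 (k + 1) s) 2 Pr
      ≤ γ * lapNorm W * lpNorm (fun s => deviation (𝓧 k s)) 2 Pr
        + (1 + γ * lapNorm W)
          * ((1 - ψ * r * ω / 2) * lpNorm (fun s => 𝓧 k s - 𝓨 k s) 2 Pr)
        + η k * (√(n : ℝ) * (d * L)) := by
  have := h.probPr
  obtain ⟨h1, h2⟩ := h.memLp_residual (h.memLp_compression k)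
  have hη := h.step_nonneg k
  have hγβ : 0 ≤ γ * lapNorm W := mul_nonneg h.gamma_nonneg lapNorm_nonneg
  have hL := h.lipschitz_pos
  have key := lpNorm_two_le_of_ae_norm_le (a := γ * lapNorm W) (b := 1 + γ * lapNorm W)
    (c := η k * (√(n : ℝ) * (d * L))) hγβ (by linarith) (by positivity)
    (h.memLp_compression (k + 1)) (h.memLp_deviation k) h1 (by
      filter_upwards [h.ae_norm_runG_le hk] with s hs
      have h3 := norm_step_sub_le h.weight h.shrink_nonempty h.constraint.shrink_isClosed
        h.constraint.shrink_convex (h.x_mem_shrink hk s) (runX_succ_apply k s) h.gamma_nonneg hη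
      have h4 := norm_sub_le_norm_sub_add_norm_sub (𝓧 (k + 1) s) (𝓧 k s) (𝓨 (k + 1) s)
      have h5 := mul_le_mul_of_nonneg_left hs hη
      linarith)
  exact key.trans (by gcongr)

theorem lpNorm_compression_zero_le :
    lpNorm (fun s => 𝓧 0 s - 𝓨 0 s) 2 Pr ≤ 2 * √(n : ℝ) * Rhi := by
  have := h.probPr
  have hR := h.outer_pos
  have h0 : MemLp (fun _ : S => (0 : ℝ)) 2 Pr := memLp_const 0
  have := lpNorm_two_le_of_ae_norm_le le_rfl le_rfl (by positivity) (h.memLp_compression 0) h0 h0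
    (a := 0) (b := 0) (c := 2 * √(n : ℝ) * Rhi)
    (.of_forall fun s => by
      have h1 := h.norm_runX_sub_consensus_le 0 s (h.constraint.zero_mem h.inner_pos)
      rw [← two_mul_sqrt_mul_sq] at h1
      have h2 := le_of_sq_le_sq h1 (by positivity)
      have h3 : ‖𝓧 0 s - 𝓨 0 s‖ ≤ 2 * √(n : ℝ) * Rhi := h2
      simpa using h3)
  simpa using this

/-- Bounding the move of `X` by the size of `Om` instead of the gradient makes this valid at `k = 0`
too. -/
theorem lpNorm_compression_succ_le_add (k : ℕ) :
    lpNorm (fun s => 𝓧 (k + 1) s - 𝓨 (k + 1) s) 2 Pr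
      ≤ (1 - ψ * r * ω / 2) * lpNorm (fun s => 𝓧 k s - 𝓨 k s) 2 Pr
        + 2 * √(n : ℝ) * Rhi := by
  have := h.probPr
  have hR := h.outer_pos
  obtain ⟨h1, h2⟩ := h.memLp_residual (h.memLp_compression k)
  have key := lpNorm_two_le_of_ae_norm_le (a := 1) (b := 0) (c := 2 * √(n : ℝ) * Rhi)
    zero_le_one le_rfl (by positivity) (h.memLp_compression (k + 1)) h1 h1
    (.of_forall fun s => by
      linarith [norm_sub_le_norm_sub_add_norm_sub (𝓧 (k + 1) s) (𝓧 k s) (𝓨 (k + 1) s),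
        h.norm_runX_succ_sub_le k s])
  linarith

theorem memLp_runX_sub_consensus (k : ℕ) {y : E d} (hy : y ∈ Om) :
    MemLp (fun s => 𝓧 k s - consensusStack n y) 2 Pr := by
  refine h.memLp_of_bound ((h.measurable_runX k).sub measurable_const).aestronglyMeasurable
    (2 * √(n : ℝ) * Rhi) (.of_forall fun s => ?_)
  have := h.outer_pos
  refine le_of_sq_le_sq ?_ (by positivity)
  rw [two_mul_sqrt_mul_sq]
  exact h.norm_runX_sub_consensus_le k s hy

theorem memLp_runG {k : ℕ} (hk : 1 ≤ k) : MemLp (𝓖 k) 2 Pr :=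
  h.memLp_of_bound (h.measurable_runG k).aestronglyMeasurable _ (h.ae_norm_runG_le hk)

theorem distance_succ_le {k : ℕ} (hk : 1 ≤ k) {y : E d} (hy : y ∈ shrink Om ε) :
    ∫ s, ‖𝓧 (k + 1) s - consensusStack n y‖ ^ 2 ∂Pr
      ≤ ∫ s, ‖𝓧 k s - consensusStack n y‖ ^ 2 ∂Pr
        + γ * (lapNorm W * (1 + 4 * lapNorm W))
          * (lpNorm (fun s => deviation (𝓧 k s)) 2 Pr ^ 2
            + ((1 - ψ * r * ω / 2) * lpNorm (fun s => 𝓧 k s - 𝓨 k s) 2 Pr) ^ 2)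
        + 2 * η k ^ 2 * (n * (d * L) ^ 2)
        - 2 * η k * ∫ s, inner ℝ (𝓧 k s - consensusStack n y) (𝓖 k s) ∂Pr := by
  have := h.probPr
  obtain ⟨h1, h2⟩ := h.memLp_residual (h.memLp_compression k)
  have hyO := h.shrink_subset hy
  have hβ : 0 ≤ lapNorm W := lapNorm_nonneg
  have hγ := h.gamma_nonneg
  have i0 : Integrable (fun s => ‖𝓧 (k + 1) s - consensusStack n y‖ ^ 2) Pr :=
    (h.memLp_runX_sub_consensus (k + 1) hyO).integrable_norm_pow (by norm_num)
  have i1 : Integrable (fun s => ‖𝓧 k s - consensusStack n y‖ ^ 2) Pr :=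
    (h.memLp_runX_sub_consensus k hyO).integrable_norm_pow (by norm_num)
  have i2 : Integrable (fun s => ‖deviation (𝓧 k s)‖ ^ 2) Pr :=
    (h.memLp_deviation k).integrable_norm_pow (by norm_num)
  have i3 : Integrable (fun s => ‖𝓧 k s - 𝓨 (k + 1) s‖ ^ 2) Pr :=
    h1.integrable_norm_pow (by norm_num)
  have i4 : Integrable (fun s => inner ℝ (𝓧 k s - consensusStack n y) (𝓖 k s)) Pr :=
    (h.memLp_runX_sub_consensus k hyO).integrable_real_inner (h.memLp_runG hk)
  set a := γ * (lapNorm W * (1 + 4 * lapNorm W))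
  have ha : 0 ≤ a := by positivity
  have i5 : Integrable (fun s => ‖deviation (𝓧 k s)‖ ^ 2 + ‖𝓧 k s - 𝓨 (k + 1) s‖ ^ 2) Pr :=
    i2.add i3
  have i6 : Integrable (fun s => ‖𝓧 k s - consensusStack n y‖ ^ 2
      + a * (‖deviation (𝓧 k s)‖ ^ 2 + ‖𝓧 k s - 𝓨 (k + 1) s‖ ^ 2)) Pr :=
    i1.add (i5.const_mul a)
  have i7 : Integrable (fun s => ‖𝓧 k s - consensusStack n y‖ ^ 2
      + a * (‖deviation (𝓧 k s)‖ ^ 2 + ‖𝓧 k s - 𝓨 (k + 1) s‖ ^ 2)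
      + 2 * η k ^ 2 * (n * (d * L) ^ 2)) Pr := i6.add (integrable_const _)
  have i8 : Integrable (fun s => ‖𝓧 k s - consensusStack n y‖ ^ 2
      + a * (‖deviation (𝓧 k s)‖ ^ 2 + ‖𝓧 k s - 𝓨 (k + 1) s‖ ^ 2)
      + 2 * η k ^ 2 * (n * (d * L) ^ 2)
      - 2 * η k * inner ℝ (𝓧 k s - consensusStack n y) (𝓖 k s)) Pr :=
    i7.sub (i4.const_mul (2 * η k))
  have hle : ∀ᵐ s ∂Pr, ‖𝓧 (k + 1) s - consensusStack n y‖ ^ 2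
      ≤ ‖𝓧 k s - consensusStack n y‖ ^ 2
        + a * (‖deviation (𝓧 k s)‖ ^ 2 + ‖𝓧 k s - 𝓨 (k + 1) s‖ ^ 2)
        + 2 * η k ^ 2 * (n * (d * L) ^ 2)
        - 2 * η k * inner ℝ (𝓧 k s - consensusStack n y) (𝓖 k s) := by
    filter_upwards [h.ae_norm_runG_le hk] with s hs
    refine (norm_sq_step_sub_consensus_le h.weight h.shrink_nonempty h.constraint.shrink_isClosed
      h.constraint.shrink_convex (runX_succ_apply k s) h.gap_nonneg hγ h.gamma_le hy).trans ?_
    have h3 := pow_le_pow_left₀ (norm_nonneg _) hs 2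
    rw [mul_pow, Real.sq_sqrt (Nat.cast_nonneg _)] at h3
    gcongr
  refine (integral_mono_ae i0 i8 hle).trans ?_
  rw [integral_sub i7 (i4.const_mul (2 * η k)), integral_add i6 (integrable_const _),
    integral_add i1 (i5.const_mul a), integral_const_mul, integral_const_mul, integral_add i2 i3,
    ← lpNorm_two_sq (h.memLp_deviation k), ← lpNorm_two_sq h1, integral_const, probReal_univ,
    one_smul, integral_const_mul]
  gcongr
  exact lpNorm_nonneg

/-! ### Regret -/

theorem measurable_objective_term (i : Fin n) : Measurable fun x => ∫ a, F i x a ∂P i :=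
  have := h.probP i
  (h.oracle i).measurable_integral

theorem integrable_objective_term (i : Fin n) {x : S → E d} (hx : Measurable x)
    (hxO : ∀ s, x s ∈ Om) : Integrable (fun s => ∫ a, F i (x s) a ∂P i) Pr := by
  have := h.probPr
  have := h.probP i
  have h0 := h.constraint.zero_mem h.inner_pos
  refine Integrable.of_bound ((h.measurable_objective_term i).comp hx).aestronglyMeasurable
    (L * Rhi + ‖∫ a, F i 0 a ∂P i‖) (.of_forall fun s => ?_)
  have h1 := (h.oracle i).abs_integral_sub_le (hxO s) h0
  rw [sub_zero, ← Real.norm_eq_abs] at h1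
  have h2 := mul_le_mul_of_nonneg_left (h.constraint.norm_le (hxO s)) h.lipschitz_pos.le
  have h3 := norm_sub_norm_le (∫ a, F i (x s) a ∂P i) (∫ a, F i 0 a ∂P i)
  linarith

/-- The gradient estimators are approximate subgradients in expectation. -/
theorem linearized_regret_ge {k : ℕ} (hk : 1 ≤ k) {y : E d} (hy : y ∈ shrink Om ε) :
    ∑ i, ∫ s, (∫ a, F i (𝓧 k s i) a ∂P i - ∫ a, F i y a ∂P i) ∂Pr - n * (2 * L * μ)
      ≤ ∫ s, inner ℝ (𝓧 k s - consensusStack n y) (𝓖 k s) ∂Pr := by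
  have := h.probPr
  have := h.probP
  have := h.probν
  have hyO := h.shrink_subset hy
  have hterm : ∀ i, Integrable (fun s => inner ℝ (𝓧 k s i - y) (𝓖 k s i)) Pr ∧
      ∫ s, (∫ a, F i (𝓧 k s i) a ∂P i - ∫ a, F i y a ∂P i) ∂Pr - 2 * L * μ
        ≤ ∫ s, inner ℝ (𝓧 k s i - y) (𝓖 k s i) ∂Pr := by
    intro i
    have hx : Measurable fun s => 𝓧 k s i := h.measurable_x k i
    have hg : Measurable fun s => 𝓖 k s i := h.measurable_gradEst_run k i
    have hφ : Measurable fun p : E d × X i × E d =>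
        inner ℝ (p.1 - y) (gradEst (F i) μ p.1 p.2.2 p.2.1) :=
      (measurable_fst.sub measurable_const).inner (measurable_gradEst (h.oracle i).measurable μ)
    have hint : Integrable (fun s => inner ℝ (𝓧 k s i - y) (𝓖 k s i)) Pr := by
      refine Integrable.of_bound ((hx.sub measurable_const).inner hg).aestronglyMeasurable
        (2 * Rhi * (d * L)) ?_
      filter_upwards [h.ae_gradEst_le hk i] with s hs
      refine (norm_inner_le_norm _ _).trans (mul_le_mul ?_ hs (norm_nonneg _)
        (by linarith [h.outer_pos]))
      linarith [norm_sub_le (𝓧 k s i) y, h.constraint.norm_le (h.x_mem k s i),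
        h.constraint.norm_le hyO]
    have hind : IndepFun (fun s => 𝓧 k s i) (fun s => (ξ i k s, dir i k s)) Pr :=
      (h.noise.indepFun_past (h.measurable_past k i).1 i).comp (φ := id)
        (ψ := fun p : X i × E d × Z => (p.1, p.2.1)) measurable_id
        (measurable_fst.prodMk measurable_snd.fst)
    -- The iterate is frozen and the fresh sample and direction are averaged out.
    have key := integral_comp_of_indepFun hx (h.noise.hasLaw_sample h.one_le_dim i k) hind hφ hint
    refine ⟨hint, ?_⟩
    have hi : Integrable (fun s => ∫ a, F i (𝓧 k s i) a ∂P i - ∫ a, F i y a ∂P i) Pr :=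
      (h.integrable_objective_term i hx fun s => h.x_mem k s i).sub (integrable_const _)
    refine le_of_le_of_eq ?_ key.2.symm
    have h1 : ∫ s, (∫ a, F i (𝓧 k s i) a ∂P i - ∫ a, F i y a ∂P i) ∂Pr - 2 * L * μ
        = ∫ s, (∫ a, F i (𝓧 k s i) a ∂P i - ∫ a, F i y a ∂P i - 2 * L * μ) ∂Pr := by
      rw [integral_sub hi (integrable_const _)]
      simp
    rw [h1]
    refine integral_mono (hi.sub (integrable_const _)) key.1 fun s => ?_
    exact (h.oracle i).integral_inner_gradEst_ge h.one_le_dim h.lipschitz_pos.le h.mu_pos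
      (fun z hz => h.add_mem (h.x_mem_shrink hk s i) hz) (fun z hz => h.add_mem hy hz)
  have hsum : ∫ s, inner ℝ (𝓧 k s - consensusStack n y) (𝓖 k s) ∂Pr
      = ∑ i, ∫ s, inner ℝ (𝓧 k s i - y) (𝓖 k s i) ∂Pr := by
    rw [← integral_finsetSum _ fun i _ => (hterm i).1]
    rfl
  rw [hsum]
  refine le_trans (le_of_eq ?_) (Finset.sum_le_sum fun i _ => (hterm i).2)
  rw [Finset.sum_sub_distrib]
  simp

theorem stackAvg_mem (k : ℕ) (s : S) : stackAvg (𝓧 k s) ∈ Om := by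
  have hn := h.weight.pos
  have := h.constraint.convex.sum_mem (t := Finset.univ) (w := fun _ : Fin n => 1 / (n : ℝ))
    (z := fun i => 𝓧 k s i) (fun _ _ => by positivity) (by simp [hn.ne'])
    (fun i _ => h.x_mem k s i)
  rwa [← Finset.smul_sum] at this

theorem integrable_regret (k : ℕ) (xstar : E d) :
    Integrable (fun s => objective P F (stackAvg (𝓧 k s)) - objective P F xstar) Pr := by
  have := h.probPr
  have hm : Measurable fun s => stackAvg (𝓧 k s) := by
    have : Continuous (stackAvg (n := n) (d := d)) := by unfold stackAvg; fun_prop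
    exact this.measurable.comp (h.measurable_runX k)
  exact ((integrable_finsetSum _ fun i _ => h.integrable_objective_term i hm
    (h.stackAvg_mem k)).const_mul _).sub (integrable_const _)

/-- Lipschitz continuity moves each local term from the iterate to the network average, at cost `L
‖deviation i‖`, and the comparator from `xstar` to its shrunk copy, at cost `L ε Rhi`.
Cauchy–Schwarz over the agents produces `√n`. -/
theorem regret_le {k : ℕ} (hk : 1 ≤ k) {xstar : E d} (hxs : xstar ∈ Om) :
    n * ∫ s, (objective P F (stackAvg (𝓧 k s)) - objective P F xstar) ∂Pr
      ≤ ∫ s, inner ℝ (𝓧 k s - consensusStack n ((1 - ε) • xstar)) (𝓖 k s) ∂Pr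
        + √(n : ℝ) * L * lpNorm (fun s => deviation (𝓧 k s)) 2 Pr + n * (2 * L * μ)
        + n * (L * (ε * Rhi)) := by
  have := h.probPr
  have := h.probP
  have hn : (n : ℝ) ≠ 0 := by exact_mod_cast h.weight.pos.ne'
  have hL := h.lipschitz_pos
  have hy : (1 - ε) • xstar ∈ shrink Om ε := Set.mem_image_of_mem _ hxs
  set y := (1 - ε) • xstar with hydef
  have hyO := h.shrink_subset hy
  have hreg := h.linearized_regret_ge hk hy
  have hxi : ∀ i, Integrable (fun s => ∫ a, F i (𝓧 k s i) a ∂P i - ∫ a, F i y a ∂P i) Pr :=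
    fun i => (h.integrable_objective_term i (h.measurable_x k i) fun s => h.x_mem k s i).sub
      (integrable_const _)
  have hdev1 : Integrable (fun s => ‖deviation (𝓧 k s)‖) Pr :=
    ((h.memLp_deviation k).integrable (by norm_num)).norm
  have hdist : ∀ i, |∫ a, F i y a ∂P i - ∫ a, F i xstar a ∂P i| ≤ L * (ε * Rhi) := fun i => by
    refine ((h.oracle i).abs_integral_sub_le hyO hxs).trans (mul_le_mul_of_nonneg_left ?_ hL.le)
    have : y - xstar = -(ε • xstar) := by rw [hydef]; module
    rw [this, norm_neg, norm_smul, Real.norm_of_nonneg h.eps_pos.le]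
    exact mul_le_mul_of_nonneg_left (h.constraint.norm_le hxs) h.eps_pos.le
  have hpt : ∀ s, n * (objective P F (stackAvg (𝓧 k s)) - objective P F xstar)
      ≤ ∑ i, (∫ a, F i (𝓧 k s i) a ∂P i - ∫ a, F i y a ∂P i)
        + √(n : ℝ) * L * ‖deviation (𝓧 k s)‖ + n * (L * (ε * Rhi)) := by
    intro s
    have h1 : n * (objective P F (stackAvg (𝓧 k s)) - objective P F xstar)
        = ∑ i, (∫ a, F i (stackAvg (𝓧 k s)) a ∂P i - ∫ a, F i xstar a ∂P i) := by
      rw [objective, objective, Finset.sum_sub_distrib]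
      field_simp
    have h2 : ∀ i, ∫ a, F i (stackAvg (𝓧 k s)) a ∂P i - ∫ a, F i xstar a ∂P i
        ≤ (∫ a, F i (𝓧 k s i) a ∂P i - ∫ a, F i y a ∂P i)
          + L * ‖deviation (𝓧 k s) i‖ + L * (ε * Rhi) := fun i => by
      have e1 := (abs_le.1 ((h.oracle i).abs_integral_sub_le (h.x_mem k s i)
        (h.stackAvg_mem k s))).1
      have e2 := (abs_le.1 (hdist i)).2
      have e3 : deviation (𝓧 k s) i = 𝓧 k s i - stackAvg (𝓧 k s) := rfl
      rw [e3]
      linarith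
    have h3 : ∑ i, ‖deviation (𝓧 k s) i‖ ≤ √(n : ℝ) * ‖deviation (𝓧 k s)‖ := by
      refine le_of_sq_le_sq ?_ (by positivity)
      rw [mul_pow, Real.sq_sqrt (Nat.cast_nonneg _), stack_norm_sq]
      simpa using sq_sum_le_card_mul_sum_sq (s := Finset.univ)
        (f := fun i => ‖deviation (𝓧 k s) i‖)
    rw [h1]
    refine (Finset.sum_le_sum fun i _ => h2 i).trans ?_
    rw [Finset.sum_add_distrib, Finset.sum_add_distrib, ← Finset.mul_sum]
    have h4 := mul_le_mul_of_nonneg_left h3 hL.le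
    simp only [Finset.sum_const, Finset.card_univ, Fintype.card_fin, nsmul_eq_mul]
    linarith
  have hs : Integrable (fun s => ∑ i, (∫ a, F i (𝓧 k s i) a ∂P i - ∫ a, F i y a ∂P i)) Pr :=
    integrable_finsetSum _ fun i _ => hxi i
  have hs2 : Integrable (fun s => ∑ i, (∫ a, F i (𝓧 k s i) a ∂P i - ∫ a, F i y a ∂P i)
      + √(n : ℝ) * L * ‖deviation (𝓧 k s)‖) Pr := hs.add (hdev1.const_mul _)
  have hs3 : Integrable (fun s => ∑ i, (∫ a, F i (𝓧 k s i) a ∂P i - ∫ a, F i y a ∂P i)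
      + √(n : ℝ) * L * ‖deviation (𝓧 k s)‖ + n * (L * (ε * Rhi))) Pr :=
    hs2.add (integrable_const _)
  rw [← integral_const_mul]
  refine (integral_mono ((h.integrable_regret k xstar).const_mul _) hs3 hpt).trans ?_
  rw [integral_add hs2 (integrable_const _), integral_add hs (hdev1.const_mul _),
    integral_finsetSum _ fun i _ => hxi i, integral_const_mul, integral_const, probReal_univ,
    one_smul]
  have h5 := mul_le_mul_of_nonneg_left (integral_norm_le_lpNorm_two (h.memLp_deviation k))
    (by positivity : 0 ≤ √(n : ℝ) * L)
  linarith

end Setting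

end Trajectory

/-! ### The main theorem. -/

theorem theorem2
    (n : ℕ) (G : SimpleGraph (Fin n)) (W : Matrix (Fin n) (Fin n) ℝ) (hW : IsWeightMatrix G W)
    (L Rlo Rhi : ℝ) (hL : 0 < L) (hRlo : 0 < Rlo) (hRhi : 0 < Rhi)
    -- `lam` only records how the constants may depend on `γ`: every admissible `γ` qualifies for `lam = γ`
    (lam : ℝ) (hlam : 0 < lam) :
    ∃ K₁ K₂ : ℝ, ∀ (d : ℕ), 1 ≤ d →
      -- the problem
      ∀ (Om : Set (E d)), IsConstraintSet Om Rlo Rhi →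
      ∀ (X : Fin n → Type u) [∀ i, MeasurableSpace (X i)] (P : ∀ i, Measure (X i))
        [∀ i, IsProbabilityMeasure (P i)] (F : ∀ i, E d → X i → ℝ),
        (∀ i, IsOracle Om L (P i) (F i)) →
      ∀ (xstar : E d), xstar ∈ Om → (∀ y ∈ Om, objective P F xstar ≤ objective P F y) →
      -- the compressor
      ∀ (Z : Type v) [MeasurableSpace Z] (ν : Measure Z) [IsProbabilityMeasure ν]
        (C : E d → Z → E d) (r ω : ℝ), 1 ≤ r → 0 < ω → ω ≤ 1 → IsCompressor ν C r ω →
      -- the parameters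
      ∀ (ψ γ c : ℝ), 0 < ψ → ψ ≤ r⁻¹ → 0 < c →
        IsGossipStep (specGap W) (lapNorm W) (ψ * r * ω / 2) γ → lam * (ψ * r * ω) ^ 2 ≤ γ →
      ∀ (T : ℕ) (μ ε : ℝ) (η : ℕ → ℝ), μ = 1 / √(T : ℝ) → ε = 2 * Rlo / √(T : ℝ) →
        0 < T → ε ≤ 1 →
        -- the query radius for which `x + μ u ∈ Om` whenever `x ∈ shrink Om ε` and `‖u‖ = 1`
        μ ≤ ε * Rlo →
        (∀ k, η k = 1 / √((k : ℝ) + c)) →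
      -- the random run
      ∀ (S : Type w) [MeasurableSpace S] (Pr : Measure S) [IsProbabilityMeasure Pr]
        (ξ : ∀ i, ℕ → S → X i) (dir : Fin n → ℕ → S → E d) (ζ : Fin n → ℕ → S → Z),
        IsNoise Pr P ν ξ dir ζ →
      ∀ (x₀ : Fin n → E d), (∀ i, x₀ i ∈ Om) →
      ∀ (xbar : ℕ → S → E d),
        (∀ k s, xbar k s = (comDSZO W Om F C μ ε ψ γ η x₀ (fun i k => ξ i k s)
          (fun i k => dir i k s) (fun i k => ζ i k s) k).avg) →
      (∀ k ∈ Finset.Icc 1 T,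
        Integrable (fun s => objective P F (xbar k s) - objective P F xstar) Pr) ∧
      ∑ k ∈ Finset.Icc 1 T, ∫ s, (objective P F (xbar k s) - objective P F xstar) ∂Pr
        ≤ K₁ * ((d : ℝ) ^ 2 * √((T : ℝ) + c))
          + K₂ * ((d : ℝ) ^ 2 / (ψ * r * ω) ^ 2 *
              (√((T : ℝ) + c) + Real.log ((T : ℝ) + c))) := by
  obtain ⟨K₁, K₂, -, hK₂, hK⟩ := exists_regret_bound (specGap W) (lapNorm W) L Rlo Rhi lam
    specGap_le_one lapNorm_nonneg hW.specGap_le_lapNorm hL hRlo hRhi hlam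
  refine ⟨K₁, K₂, ?_⟩
  intro d hd Om hOm X _ P hP F hF xstar hxs _ Z _ ν hν C r ω hr hω hω1 hC ψ γ c hψ hψr hc hγ hlamγ
    T μ ε η hμ hε hT hε1 hμε hη S _ Pr hPr ξ dir ζ hnoise x₀ hx₀ xbar hxbar
  have hr0 : 0 < r := one_pos.trans_le hr
  have hT1 : (1 : ℝ) ≤ T := by exact_mod_cast hT
  have hψr1 : ψ * r ≤ 1 := by rwa [← le_div_iff₀ hr0, one_div]
  have hs0 : 0 < ψ * r * ω := by positivity
  have hs1 : ψ * r * ω ≤ 1 := mul_le_one₀ hψr1 hω.le hω1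
  have h : Setting G W Om L Rlo Rhi P F ν C r ω μ ε ψ γ η x₀ Pr ξ dir ζ :=
    { weight := hW
      gap_nonneg := hγ.specGap_pos.le
      one_le_dim := hd
      lipschitz_pos := hL
      inner_pos := hRlo
      outer_pos := hRhi
      constraint := hOm
      probP := hP
      oracle := hF
      probν := hν
      compressor := hC
      scaling_pos := hr0
      psi_nonneg := hψ.le
      psi_mul_le := hψr1
      rate_le := hs1
      gamma_nonneg := hγ.1.le
      gamma_le := hγ.2.1.le
      mu_pos := by rw [hμ]; positivity
      eps_pos := by rw [hε]; positivity
      eps_le := hε1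
      mu_le := hμε
      step_nonneg := fun k => by rw [hη]; positivity
      init_mem := hx₀
      probPr := hPr
      noise := hnoise }
  have hbar : ∀ k s, xbar k s = stackAvg (runX ξ dir ζ W Om F C μ ε ψ γ η x₀ k s) := hxbar
  simp only [hbar]
  refine ⟨fun k _ => h.integrable_regret k xstar, ?_⟩
  have hy : (1 - ε) • xstar ∈ shrink Om ε := Set.mem_image_of_mem _ hxs
  have hyO := h.shrink_subset hy
  refine (hK n d T c (ψ * r * ω) γ μ ε η
    (fun k => lpNorm (fun s => deviation (runX ξ dir ζ W Om F C μ ε ψ γ η x₀ k s)) 2 Pr)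
    (fun k => lpNorm (fun s => runX ξ dir ζ W Om F C μ ε ψ γ η x₀ k s
      - runXhat ξ dir ζ W Om F C μ ε ψ γ η x₀ k s) 2 Pr)
    (fun k => ∫ s, ‖runX ξ dir ζ W Om F C μ ε ψ γ η x₀ k s
      - consensusStack n ((1 - ε) • xstar)‖ ^ 2 ∂Pr)
    (fun k => ∫ s, inner ℝ (runX ξ dir ζ W Om F C μ ε ψ γ η x₀ k s
      - consensusStack n ((1 - ε) • xstar)) (runG ξ dir ζ W Om F C μ ε ψ γ η x₀ k s) ∂Pr)
    _ hW.pos hd hT hc hs0 hs1 hγ hlamγ hμ hε hη (fun _ => lpNorm_nonneg) (fun _ => lpNorm_nonneg)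
    (fun _ => integral_nonneg fun _ => sq_nonneg _) (fun k _ => h.lpNorm_deviation_le k)
    h.lpNorm_compression_zero_le h.lpNorm_compression_succ_le_add ?_
    (fun _ => h.lpNorm_deviation_succ_le) (fun _ => h.lpNorm_compression_succ_le)
    (fun _ hk => h.distance_succ_le hk hy) (fun _ hk => h.regret_le hk hxs)).trans ?_
  · intro k _
    refine (integral_mono ((h.memLp_runX_sub_consensus k hyO).integrable_norm_pow (by norm_num))
      (integrable_const _) fun s => h.norm_runX_sub_consensus_le k s hyO).trans_eq ?_
    simp
  -- Since `T + c ≥ 1`, the logarithm is nonnegative and may be added to the bound.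
  · have hlog : 0 ≤ Real.log ((T : ℝ) + c) := Real.log_nonneg (by linarith)
    gcongr
    linarith
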